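/- Let $\Gamma$ be a countably infinite discrete group acting continuously on a locally compact Hausdorff second countable space $X$. **The semigroup $\mathcal W(X,\Gamma)$.** Let $\mathcal K(X,\Gamma)$ be the set of nonempty finite sequences $(O_1,\dots,O_n)$, $n\ge 1$, of (possibly empty) open subsets of $X$. For $a=(O_1,\dots,O_n)$ and $b=(V_1,\dots,V_m)$ write $a\preccurlyeq b$ if for all compact sets $F_1\subset O_1,\dots,F_n\subset O_n$ there are, for each $i\le n$, finitely many open sets $U^{(i)}_1,\dots,U^{(i)}_{J_i}$ covering $F_i$, elements $s^{(i)}_j\in\Gamma$ and indices $k^{(i)}_j\in\{1,\dots,m\}$ such that the sets $s^{(i)}_jU^{(i)}_j\times\{k^{(i)}_j\}$ ($i\le n$, $j\le J_i$) are pairwise disjoint and contained in $\bigsqcup_{l=1}^m V_l\times\{l\}$. This is a preorder; put $a\approx b$ if $a\preccurlyeq b\preccurlyeq a$. Then $\mathcal W(X,\Gamma)=\mathcal K(X,\Gamma)/{\approx}$ is a commutative monoid under $[a]+[b]=[(a,b)]$ (concatenation), with zero $[(\emptyset)]$, partially ordered by $[a]\le[b]\iff a\preccurlyeq b$. Write $a\ll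 b$ if $a=(O_1,\dots,O_n)$ and $b=(U_1,\dots,U_n)$ have the same length and each $\overline{O_i}$ is compact and contained in $U_i$, and equip $\mathcal W(X,\Gamma)$ with the relation $\prec$ given by: $[a]\prec[b]$ if and only if $a\preccurlyeq c\ll b$ for some $c\in\mathcal K(X,\Gamma)$ (this is well defined). **Axioms.** A *positively partially ordered monoid* is a commutative monoid $S$ with a translation-invariant partial order $\le$ such that $0\le a$ for all $a$. An *auxiliary relation* on $S$ is a relation $\prec$ such that $a\prec b\Rightarrow a\le b$; $a\le b\prec c\le d\Rightarrow a\prec d$; and $0\prec a$ for all $a$. Put $a^\prec=\{b: b\prec a\}$. The axioms for $(S,\le,\prec)$ are: - (W1) For every $a$ there is a sequence $(a_k)_k$ in $a^\prec$ with $a_k\prec a_{k+1}$ for all $k$ such that every $b\in a^\prec$ satisfies $b\prec a_k$ for some $k$. - (W2) $a=\sup a^\prec$ for every $a$. - (W3) $a'\prec a$ and $b'\prec b$ imply $a'+b'\prec a+b$. - (W4) If $a\prec b+c$, there are $b'\prec b$ and $c'\prec c$ with $a\prec b'+c'$. - (W5) If $a+b\prec c$, $a'\prec a$, $b'\prec b$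 and $c\prec\tilde c$, there are $x',x$ with $a'+x\prec\tilde c$, $c\prec a+x'$ and $b'\prec x'\prec x$. - (W6) If $a'\prec a\prec b+c$, there are $e,f$ with $a'\prec e+f$, $e\prec a$, $e\prec b$, $f\prec a$ and $f\prec c$. A *W-semigroup* is a positively partially ordered monoid with an auxiliary relation satisfying (W1)–(W4). Its completion $\gamma(S)$ is the set of sequences $(a_k)_{k\in\mathbb N}$ in $S$ with $a_k\prec a_{k+1}$ for all $k$, preordered by $(a_k)\lesssim(b_k)$ if for every $k$ there is $n$ with $a_k\prec b_n$, modulo the equivalence relation $x\lesssim y\lesssim x$, with the induced order and termwise addition. In a positively partially ordered monoid write $a\ll b$ (way-below) if, whenever an increasing sequence $(s_n)$ has a supremum with $b\le\sup_n s_n$, one has $a\le s_m$ for some $m$. A *Cu-semigroup* is a positively partially ordered monoid such that: (O1) every increasing sequence has a supremum; (O2) every element is the supremum of a sequence $(a_k)$ with $a_k\ll a_{k+1}$ for all $k$; (O3) $a'\ll a$ and $b'\ll b$ imply $a'+b'\ll a+b$; (O4) $\sup_n(a_n+b_n)=\sup_n a_n+\sup_n b_n$ for all increasing sequences $(a_n)$,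 $(b_n)$. Further axioms are: - (O5) If $a+b\le c$, $a'\ll a$ and $b'\ll b$, there is $x$ with $a'+x\le c\le a+x$ and $b'\le x$. - (O6) If $a'\ll a\le b+c$, there are $e,f$ with $a'\le e+f$, $e\le a$, $e\le b$, $f\le a$ and $f\le c$. **Theorem.** $(\mathcal W(X,\Gamma),\le,\prec)$ is a W-semigroup, that is, a positively partially ordered monoid with auxiliary relation $\prec$ satisfying (W1)–(W4), and it satisfies (W6); its completion $\gamma(\mathcal W(X,\Gamma))$ is a Cu-semigroup satisfying (O6). If in addition $X$ is zero-dimensional (its topology has a basis of compact open sets), then $\mathcal W(X,\Gamma)$ satisfies (W5) and $\gamma(\mathcal W(X,\Gamma))$ satisfies (O5). -/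

import Mathlib

open TopologicalSpace
open scoped Pointwise

universe u v

section OrderedMonoids

/-- A positively partially ordered (commutative) monoid: the partial order is translation-invariant
and every element is positive. -/
structure IsPositivelyOrdered (S : Type u) [AddCommMonoid S] [PartialOrder S] : Prop where
  add_le_add_right : ∀ a b c : S, a ≤ b → a + c ≤ b + c
  zero_le : ∀ a : S, 0 ≤ a

/-- The (sequential) way-below relation of a partially ordered set. -/
def WayBelow {S : Type u} [PartialOrder S] (a b : S) : Prop :=
  ∀ (x : ℕ → S) (s : S), Monotone x → IsLUB (Set.range x) s → b ≤ s → ∃ m, a ≤ x m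

/-- Auxiliary relations on a positively ordered monoid. -/
structure IsAuxiliary {S : Type u} [AddCommMonoid S] [PartialOrder S]
    (r : S → S → Prop) : Prop where
  le_of_rel : ∀ a b, r a b → a ≤ b
  rel_of_le_of_rel_of_le : ∀ a b c d, a ≤ b → r b c → c ≤ d → r a d
  zero_rel : ∀ a, r 0 a

/-- Axiom (W1). -/
def AxiomW1 {S : Type u} (r : S → S → Prop) : Prop :=
  ∀ a : S, ∃ x : ℕ → S, (∀ k, r (x k) a) ∧ (∀ k, r (x k) (x (k + 1))) ∧
    ∀ b, r b a → ∃ k, r b (x k)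

/-- Axiom (W2). -/
def AxiomW2 {S : Type u} [PartialOrder S] (r : S → S → Prop) : Prop :=
  ∀ a : S, IsLUB {b | r b a} a

/-- Axiom (W3). -/
def AxiomW3 {S : Type u} [AddCommMonoid S] (r : S → S → Prop) : Prop :=
  ∀ a' a b' b : S, r a' a → r b' b → r (a' + b') (a + b)

/-- Axiom (W4). -/
def AxiomW4 {S : Type u} [AddCommMonoid S] (r : S → S → Prop) : Prop :=
  ∀ a b c : S, r a (b + c) → ∃ b' c', r a (b' + c') ∧ r b' b ∧ r c' c

/-- Axiom (W5). -/
def AxiomW5 {S : Type u} [AddCommMonoid S] (r : S → S → Prop) : Prop :=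
  ∀ a' a b' b c d : S, r (a + b) c → r a' a → r b' b → r c d →
    ∃ x' x, r (a' + x) d ∧ r c (a + x') ∧ r b' x' ∧ r x' x

/-- Axiom (W6). -/
def AxiomW6 {S : Type u} [AddCommMonoid S] (r : S → S → Prop) : Prop :=
  ∀ a' a b c : S, r a' a → r a (b + c) →
    ∃ e f, r a' (e + f) ∧ r e a ∧ r e b ∧ r f a ∧ r f c

/-- W-semigroups: positively partially ordered monoids with an auxiliary relation satisfying
(W1)-(W4). -/
structure IsWSemigroup (S : Type u) [AddCommMonoid S] [PartialOrder S]
    (r : S → S → Prop) : Prop where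
  positivelyOrdered : IsPositivelyOrdered S
  auxiliary : IsAuxiliary r
  w1 : AxiomW1 r
  w2 : AxiomW2 r
  w3 : AxiomW3 r
  w4 : AxiomW4 r

/-- Axiom (O1): increasing sequences have suprema. -/
def AxiomO1 (S : Type u) [PartialOrder S] : Prop :=
  ∀ x : ℕ → S, Monotone x → ∃ s, IsLUB (Set.range x) s

/-- Axiom (O2): every element is the supremum of a way-below-increasing sequence. -/
def AxiomO2 (S : Type u) [PartialOrder S] : Prop :=
  ∀ a : S, ∃ x : ℕ → S, (∀ k, WayBelow (x k) (x (k + 1))) ∧ IsLUB (Set.range x) a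

/-- Axiom (O3): addition preserves the way-below relation. -/
def AxiomO3 (S : Type u) [AddCommMonoid S] [PartialOrder S] : Prop :=
  ∀ a' a b' b : S, WayBelow a' a → WayBelow b' b → WayBelow (a' + b') (a + b)

/-- Axiom (O4): addition preserves suprema of increasing sequences. -/
def AxiomO4 (S : Type u) [AddCommMonoid S] [PartialOrder S] : Prop :=
  ∀ (x y : ℕ → S) (s t : S), Monotone x → Monotone y → IsLUB (Set.range x) s →
    IsLUB (Set.range y) t → IsLUB (Set.range fun n => x n + y n) (s + t)

/-- Axiom (O5): almost algebraic order. -/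
def AxiomO5 (S : Type u) [AddCommMonoid S] [PartialOrder S] : Prop :=
  ∀ a' a b' b c : S, a + b ≤ c → WayBelow a' a → WayBelow b' b →
    ∃ x, a' + x ≤ c ∧ c ≤ a + x ∧ b' ≤ x

/-- Axiom (O6): almost Riesz decomposition. -/
def AxiomO6 (S : Type u) [AddCommMonoid S] [PartialOrder S] : Prop :=
  ∀ a' a b c : S, WayBelow a' a → a ≤ b + c →
    ∃ e f, a' ≤ e + f ∧ e ≤ a ∧ e ≤ b ∧ f ≤ a ∧ f ≤ c

/-- Cu-semigroups: positively partially ordered monoids satisfying (O1)-(O4). -/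
structure IsCuSemigroup (S : Type u) [AddCommMonoid S] [PartialOrder S] : Prop where
  positivelyOrdered : IsPositivelyOrdered S
  o1 : AxiomO1 S
  o2 : AxiomO2 S
  o3 : AxiomO3 S
  o4 : AxiomO4 S

end OrderedMonoids

section Completion

/-- Sequences that increase with respect to the relation `r`. -/
def RapidSeq {S : Type u} (r : S → S → Prop) : Type u :=
  {x : ℕ → S // ∀ k, r (x k) (x (k + 1))}

/-- The preorder on `r`-increasing sequences. -/
def RapidSeq.Le {S : Type u} {r : S → S → Prop} (x y : RapidSeq r) : Prop :=
  ∀ k, ∃ n, r (x.1 k) (y.1 n)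

theorem RapidSeq.Le.refl {S : Type u} {r : S → S → Prop} (x : RapidSeq r) : RapidSeq.Le x x :=
  fun k => ⟨k + 1, x.2 k⟩

variable {S : Type u} [AddCommMonoid S] [PartialOrder S] {r : S → S → Prop}

theorem IsWSemigroup.rel_trans (h : IsWSemigroup S r) {a b c : S} (hab : r a b) (hbc : r b c) :
    r a c :=
  h.auxiliary.rel_of_le_of_rel_of_le a b c c (h.auxiliary.le_of_rel a b hab) hbc le_rfl

theorem RapidSeq.Le.trans (h : IsWSemigroup S r) {x y z : RapidSeq r} (hxy : RapidSeq.Le x y)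
    (hyz : RapidSeq.Le y z) : RapidSeq.Le x z := by
  intro k
  obtain ⟨n, hn⟩ := hxy k
  obtain ⟨m, hm⟩ := hyz n
  exact ⟨m, h.rel_trans hn hm⟩

theorem RapidSeq.rel_of_rel_of_le (h : IsWSemigroup S r) (y : RapidSeq r) {a : S} {n N : ℕ}
    (hn : r a (y.1 n)) (hN : n ≤ N) : r a (y.1 N) := by
  induction N, hN using Nat.le_induction with
  | base => exact hn
  | succ m _ ih => exact h.rel_trans ih (y.2 m)

/-- Termwise addition of `r`-increasing sequences. -/
def RapidSeq.add (h : IsWSemigroup S r) (x y : RapidSeq r) : RapidSeq r :=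
  ⟨fun k => x.1 k + y.1 k, fun k => h.w3 _ _ _ _ (x.2 k) (y.2 k)⟩

/-- The constant sequence zero. -/
def RapidSeq.zero (h : IsWSemigroup S r) : RapidSeq r :=
  ⟨fun _ => 0, fun _ => h.auxiliary.zero_rel 0⟩

theorem RapidSeq.add_le_add (h : IsWSemigroup S r) {x x' y y' : RapidSeq r}
    (hx : RapidSeq.Le x x') (hy : RapidSeq.Le y y') :
    RapidSeq.Le (RapidSeq.add h x y) (RapidSeq.add h x' y') := by
  intro k
  obtain ⟨n, hn⟩ := hx k
  obtain ⟨m, hm⟩ := hy k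
  exact ⟨max n m, h.w3 _ _ _ _ (x'.rel_of_rel_of_le h hn (le_max_left n m))
    (y'.rel_of_rel_of_le h hm (le_max_right n m))⟩

/-- Two `r`-increasing sequences are identified if each is below the other. -/
def RapidSeq.setoid (h : IsWSemigroup S r) : Setoid (RapidSeq r) where
  r x y := RapidSeq.Le x y ∧ RapidSeq.Le y x
  iseqv :=
    { refl := fun x => ⟨RapidSeq.Le.refl x, RapidSeq.Le.refl x⟩
      symm := fun hxy => ⟨hxy.2, hxy.1⟩
      trans := fun hxy hyz => ⟨hxy.1.trans h hyz.1, hyz.2.trans h hxy.2⟩ }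

/-- The completion `γ(S)` of a W-semigroup `S`: classes of sequences `x` in `S` that increase with
respect to the auxiliary relation `r`, where `[x] ≤ [y]` means that every `x k` is `r`-below some
`y n`, and addition is termwise. An element `a` of `S` corresponds to the class of any `r`-increasing
sequence below `a` that is cofinal among the elements `r`-below `a`, as provided by (W1). -/
def CuCompletion (h : IsWSemigroup S r) : Type u := Quotient (RapidSeq.setoid h)

namespace CuCompletion

instance instAdd (h : IsWSemigroup S r) : Add (CuCompletion h) where
  add := Quotient.map₂ (RapidSeq.add h) fun _ _ hx _ _ hy =>
    ⟨RapidSeq.add_le_add h hx.1 hy.1, RapidSeq.add_le_add h hx.2 hy.2⟩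

instance instZero (h : IsWSemigroup S r) : Zero (CuCompletion h) where
  zero := Quotient.mk (RapidSeq.setoid h) (RapidSeq.zero h)

instance instAddCommMonoid (h : IsWSemigroup S r) : AddCommMonoid (CuCompletion h) where
  add_assoc := by
    rintro ⟨x⟩ ⟨y⟩ ⟨z⟩
    exact congrArg (Quotient.mk (RapidSeq.setoid h))
      (Subtype.ext (funext fun k => add_assoc (x.1 k) (y.1 k) (z.1 k)))
  zero_add := by
    rintro ⟨x⟩
    exact congrArg (Quotient.mk (RapidSeq.setoid h))
      (Subtype.ext (funext fun k => zero_add (x.1 k)))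
  add_zero := by
    rintro ⟨x⟩
    exact congrArg (Quotient.mk (RapidSeq.setoid h))
      (Subtype.ext (funext fun k => add_zero (x.1 k)))
  add_comm := by
    rintro ⟨x⟩ ⟨y⟩
    exact congrArg (Quotient.mk (RapidSeq.setoid h))
      (Subtype.ext (funext fun k => add_comm (x.1 k) (y.1 k)))
  nsmul := nsmulRec

instance instPartialOrder (h : IsWSemigroup S r) : PartialOrder (CuCompletion h) where
  le := Quotient.lift₂ RapidSeq.Le fun _ _ _ _ hx hy => propext
    ⟨fun hxy => (hx.2.trans h hxy).trans h hy.1, fun hxy => (hx.1.trans h hxy).trans h hy.2⟩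
  le_refl := by
    rintro ⟨x⟩
    exact RapidSeq.Le.refl x
  le_trans := by
    rintro ⟨x⟩ ⟨y⟩ ⟨z⟩ hxy hyz
    exact RapidSeq.Le.trans h hxy hyz
  le_antisymm := by
    rintro ⟨x⟩ ⟨y⟩ hxy hyx
    exact Quotient.sound (s := RapidSeq.setoid h) ⟨hxy, hyx⟩

end CuCompletion

end Completion

/-- The elements of `K(X, Γ)`: nonempty finite sequences of open subsets of `X`. -/
structure OpenTuple (X : Type u) [TopologicalSpace X] where
  len : ℕ
  len_pos : 0 < len
  sets : Fin len → Opens X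

namespace OpenTuple

section Basic

variable {X : Type u} [TopologicalSpace X]

/-- Concatenation of finite sequences. -/
def append (a b : OpenTuple X) : OpenTuple X where
  len := a.len + b.len
  len_pos := Nat.add_pos_left a.len_pos _
  sets := Fin.append a.sets b.sets

/-- The one-term sequence whose only member is the empty set. -/
def empty : OpenTuple X where
  len := 1
  len_pos := Nat.one_pos
  sets := fun _ => ⊥

/-- The relation `a ≪ b`: both sequences have the same length, and every member of `a` has compact
closure contained in the corresponding member of `b`. -/
def StrictlyInside (a b : OpenTuple X) : Prop :=
  ∃ h : a.len = b.len, ∀ i : Fin a.len,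
    IsCompact (closure (a.sets i : Set X)) ∧
      closure (a.sets i : Set X) ⊆ (b.sets (Fin.cast h i) : Set X)

end Basic

variable {X : Type u} (Γ : Type v) [TopologicalSpace X] [Group Γ] [MulAction Γ X]

/-- The relation `a ≼ b`. For every choice of compact sets `F i ⊆ a i` there are finitely many open
sets `U i j` covering `F i`, and translates `s i j • U i j` that can be placed, pairwise disjointly,
into the levels `k i j` of `b`. -/
def Subequiv (a b : OpenTuple X) : Prop :=
  ∀ F : Fin a.len → Set X, (∀ i, IsCompact (F i) ∧ F i ⊆ (a.sets i : Set X)) →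
    ∃ (J : Fin a.len → ℕ) (U : ∀ i, Fin (J i) → Opens X) (s : ∀ i, Fin (J i) → Γ)
      (k : ∀ i, Fin (J i) → Fin b.len),
      (∀ i, F i ⊆ ⋃ j, (U i j : Set X)) ∧
      (∀ i j, s i j • (U i j : Set X) ⊆ (b.sets (k i j) : Set X)) ∧
      (∀ p q : (Σ i, Fin (J i)), p ≠ q → k p.1 p.2 = k q.1 q.2 →
        Disjoint (s p.1 p.2 • (U p.1 p.2 : Set X)) (s q.1 q.2 • (U q.1 q.2 : Set X)))

/-- The relation `a ≺ b` on `K(X, Γ)`. -/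
def Prec (a b : OpenTuple X) : Prop :=
  ∃ c : OpenTuple X, Subequiv Γ a c ∧ StrictlyInside c b

variable {Γ}

theorem subequiv_aux {a b : OpenTuple X} {F : Fin a.len → Set X} {ι : Fin a.len → Type}
    [∀ i, Fintype (ι i)] (U : ∀ i, ι i → Opens X) (s : ∀ i, ι i → Γ)
    (k : ∀ i, ι i → Fin b.len)
    (h1 : ∀ i, F i ⊆ ⋃ j, (U i j : Set X))
    (h2 : ∀ i j, s i j • (U i j : Set X) ⊆ (b.sets (k i j) : Set X))
    (h3 : ∀ p q : (Σ i, ι i), p ≠ q → k p.1 p.2 = k q.1 q.2 →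
        Disjoint (s p.1 p.2 • (U p.1 p.2 : Set X)) (s q.1 q.2 • (U q.1 q.2 : Set X))) :
    ∃ (J : Fin a.len → ℕ) (U : ∀ i, Fin (J i) → Opens X) (s : ∀ i, Fin (J i) → Γ)
      (k : ∀ i, Fin (J i) → Fin b.len),
      (∀ i, F i ⊆ ⋃ j, (U i j : Set X)) ∧
      (∀ i j, s i j • (U i j : Set X) ⊆ (b.sets (k i j) : Set X)) ∧
      (∀ p q : (Σ i, Fin (J i)), p ≠ q → k p.1 p.2 = k q.1 q.2 →
        Disjoint (s p.1 p.2 • (U p.1 p.2 : Set X)) (s q.1 q.2 • (U q.1 q.2 : Set X))) := by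
  let e : ∀ i, Fin (Fintype.card (ι i)) ≃ ι i := fun i => (Fintype.equivFin (ι i)).symm
  refine ⟨fun i => Fintype.card (ι i), fun i j => U i (e i j), fun i j => s i (e i j),
    fun i j => k i (e i j), ?_, fun i j => h2 i (e i j), ?_⟩
  · intro i x hx
    obtain ⟨j, hj⟩ := Set.mem_iUnion.1 (h1 i hx)
    exact Set.mem_iUnion.2 ⟨(e i).symm j, by simpa using hj⟩
  · rintro ⟨i, j⟩ ⟨i', j'⟩ hne hk
    refine h3 ⟨i, e i j⟩ ⟨i', e i' j'⟩ ?_ hk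
    intro heq
    apply hne
    obtain ⟨rfl, h⟩ := Sigma.mk.inj_iff.1 heq
    rw [(e i).injective (eq_of_heq h)]

theorem subequiv_of_map {a b : OpenTuple X} (f : Fin a.len → Fin b.len)
    (hf : ∀ i, a.sets i ≤ b.sets (f i))
    (hd : ∀ i j, i ≠ j → f i = f j → Disjoint (a.sets i : Set X) (a.sets j : Set X)) :
    Subequiv Γ a b := by
  intro F hF
  refine subequiv_aux (ι := fun _ => Unit) (fun i _ => a.sets i) (fun _ _ => 1) (fun i _ => f i)
    (fun i x hx => Set.mem_iUnion.2 ⟨(), (hF i).2 hx⟩) (fun i _ => by simpa using hf i) ?_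
  rintro ⟨i, _⟩ ⟨j, _⟩ hne hk
  simp only [one_smul]
  exact hd i j (fun h => hne (by subst h; rfl)) hk

theorem Subequiv.refl (a : OpenTuple X) : Subequiv Γ a a :=
  subequiv_of_map id (fun _ => le_rfl) (fun _ _ h h' => absurd h' h)

theorem exists_compact_levels [ContinuousConstSMul Γ X] [T2Space X] {n m : ℕ}
    {F : Fin n → Set X} (hF : ∀ i, IsCompact (F i)) {J : Fin n → ℕ}
    {U : ∀ i, Fin (J i) → Opens X} (s : ∀ i, Fin (J i) → Γ) (k : ∀ i, Fin (J i) → Fin m)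
    (V : Fin m → Opens X) (h1 : ∀ i, F i ⊆ ⋃ j, (U i j : Set X))
    (h2 : ∀ i j, s i j • (U i j : Set X) ⊆ (V (k i j) : Set X)) :
    ∃ G : Fin m → Set X, (∀ l, IsCompact (G l) ∧ G l ⊆ (V l : Set X)) ∧
      ∀ i, ∀ x ∈ F i, ∃ j, x ∈ U i j ∧ s i j • x ∈ G (k i j) := by
  have key : ∀ i, ∃ C : Fin (J i) → Set X, (∀ j, IsCompact (C j)) ∧
      (∀ j, C j ⊆ (U i j : Set X)) ∧ F i = ⋃ j ∈ (Finset.univ : Finset (Fin (J i))), C j :=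
    fun i => (hF i).finite_compact_cover Finset.univ (fun j => (U i j : Set X))
      (fun j _ => (U i j).isOpen) (by simpa using h1 i)
  choose C hC hCU hCF using key
  refine ⟨fun l => ⋃ p : {p : (Σ i, Fin (J i)) // k p.1 p.2 = l},
    s p.1.1 p.1.2 • C p.1.1 p.1.2, fun l => ⟨?_, ?_⟩, ?_⟩
  · exact isCompact_iUnion fun p => (hC p.1.1 p.1.2).smul _
  · refine Set.iUnion_subset ?_
    rintro ⟨⟨i, j⟩, rfl⟩
    exact (Set.smul_set_mono (hCU i j)).trans (h2 i j)
  · intro i x hx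
    rw [hCF i] at hx
    simp only [Finset.mem_univ, Set.iUnion_true, Set.mem_iUnion] at hx
    obtain ⟨j, hj⟩ := hx
    exact ⟨j, hCU i j hj, Set.mem_iUnion.2 ⟨⟨⟨i, j⟩, rfl⟩, Set.smul_mem_smul_set hj⟩⟩

theorem Subequiv.trans [ContinuousConstSMul Γ X] [T2Space X] {a b c : OpenTuple X}
    (hab : Subequiv Γ a b) (hbc : Subequiv Γ b c) : Subequiv Γ a c := by
  intro F hF
  obtain ⟨J, U, s, k, h1, h2, h3⟩ := hab F hF
  obtain ⟨G, hG, hFG⟩ := exists_compact_levels (fun i => (hF i).1) s k b.sets h1 h2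
  obtain ⟨J', U', s', k', h1', h2', h3'⟩ := hbc G hG
  refine subequiv_aux (ι := fun i => Σ j : Fin (J i), Fin (J' (k i j)))
    (fun i p => ⟨(U i p.1 : Set X) ∩ (fun x => s i p.1 • x) ⁻¹' (U' _ p.2 : Set X),
      (U i p.1).isOpen.inter ((U' _ p.2).isOpen.preimage (continuous_const_smul _))⟩)
    (fun i p => s' _ p.2 * s i p.1) (fun i p => k' _ p.2) ?_ ?_ ?_
  · intro i x hx
    obtain ⟨j, hj, hjG⟩ := hFG i x hx
    obtain ⟨q, hq⟩ := Set.mem_iUnion.1 (h1' _ hjG)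
    exact Set.mem_iUnion.2 ⟨⟨j, q⟩, hj, hq⟩
  · rintro i ⟨j, q⟩ _ ⟨x, ⟨-, hx⟩, rfl⟩
    refine h2' _ q ⟨s i j • x, hx, ?_⟩
    simp [mul_smul]
  · rintro ⟨i, j, q⟩ ⟨i', j', q'⟩ hne hk
    rw [Set.disjoint_left]
    rintro _ ⟨x, ⟨hx, hx'⟩, rfl⟩ ⟨y, ⟨hy, hy'⟩, hxy⟩
    simp only [mul_smul] at hxy hk
    by_cases hpq : (⟨k i j, q⟩ : Σ l, Fin (J' l)) = ⟨k i' j', q'⟩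
    · have hs : s' (k i j) q = s' (k i' j') q' :=
        congrArg (fun p : (Σ l, Fin (J' l)) => s' p.1 p.2) hpq
      have hkk : k i j = k i' j' := congrArg Sigma.fst hpq
      have hxy' : s i' j' • y = s i j • x := by
        rw [hs] at hxy
        exact smul_left_cancel _ hxy
      by_cases hij : (⟨i, j⟩ : Σ i, Fin (J i)) = ⟨i', j'⟩
      · obtain ⟨rfl, h⟩ := Sigma.mk.inj_iff.1 hij
        obtain rfl := eq_of_heq h
        obtain ⟨-, h'⟩ := Sigma.mk.inj_iff.1 hpq
        obtain rfl := eq_of_heq h'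
        exact hne rfl
      · exact Set.disjoint_left.1 (h3 ⟨i, j⟩ ⟨i', j'⟩ hij hkk)
          (Set.smul_mem_smul_set hx) ⟨y, hy, hxy'⟩
    · exact Set.disjoint_left.1 (h3' ⟨k i j, q⟩ ⟨k i' j', q'⟩ hpq hk)
        ⟨s i j • x, hx', rfl⟩ ⟨s i' j' • y, hy', by simpa using hxy⟩

theorem subequiv_append {a a' b b' : OpenTuple X} (ha : Subequiv Γ a a')
    (hb : Subequiv Γ b b') : Subequiv Γ (a.append b) (a'.append b') := by
  classical
  intro F hF
  obtain ⟨J, U, s, k, h1, h2, h3⟩ := ha (fun i => F (Fin.castAdd b.len i)) fun i => by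
    simpa [append] using hF (Fin.castAdd b.len i)
  obtain ⟨J', U', s', k', h1', h2', h3'⟩ := hb (fun i => F (Fin.natAdd a.len i)) fun i => by
    simpa [append] using hF (Fin.natAdd a.len i)
  let P : Type := (Σ i, Fin (J i)) ⊕ (Σ i, Fin (J' i))
  let lev : P → Fin (a.len + b.len) :=
    Sum.elim (fun p => Fin.castAdd b.len p.1) (fun p => Fin.natAdd a.len p.1)
  let W : P → Opens X := Sum.elim (fun p => U p.1 p.2) (fun p => U' p.1 p.2)
  let t : P → Γ := Sum.elim (fun p => s p.1 p.2) (fun p => s' p.1 p.2)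
  let m : P → Fin (a'.len + b'.len) :=
    Sum.elim (fun p => Fin.castAdd b'.len (k p.1 p.2)) (fun p => Fin.natAdd a'.len (k' p.1 p.2))
  have hdisj : ∀ p q : P, p ≠ q → m p = m q →
      Disjoint (t p • (W p : Set X)) (t q • (W q : Set X)) := by
    rintro (p | p) (q | q) hne hk
    · exact h3 p q (fun h => hne (congrArg _ h)) (Fin.castAdd_injective _ _ hk)
    · have := congrArg Fin.val hk
      simp only [m, Sum.elim_inl, Sum.elim_inr, Fin.val_castAdd, Fin.val_natAdd] at this
      omega
    · have := congrArg Fin.val hk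
      simp only [m, Sum.elim_inl, Sum.elim_inr, Fin.val_castAdd, Fin.val_natAdd] at this
      omega
    · exact h3' p q (fun h => hne (congrArg _ h)) (Fin.natAdd_injective _ _ hk)
  refine subequiv_aux (ι := fun i => {p : P // lev p = i}) (fun i p => W p.1) (fun i p => t p.1)
    (fun i p => m p.1) ?_ ?_ ?_
  · intro i x hx
    change Fin (a.len + b.len) at i
    induction i using Fin.addCases with
    | left i =>
      obtain ⟨j, hj⟩ := Set.mem_iUnion.1 (h1 i hx)
      exact Set.mem_iUnion.2 ⟨⟨Sum.inl ⟨i, j⟩, rfl⟩, hj⟩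
    | right i =>
      obtain ⟨j, hj⟩ := Set.mem_iUnion.1 (h1' i hx)
      exact Set.mem_iUnion.2 ⟨⟨Sum.inr ⟨i, j⟩, rfl⟩, hj⟩
  · rintro i ⟨p | p, -⟩
    · simpa [append, m, t, W] using h2 p.1 p.2
    · simpa [append, m, t, W] using h2' p.1 p.2
  · rintro ⟨i, p, rfl⟩ ⟨j, q, rfl⟩ hne hk
    refine hdisj p q (fun h => ?_) hk
    subst h
    exact hne rfl

theorem append_comm_subequiv (a b : OpenTuple X) : Subequiv Γ (a.append b) (b.append a) := by
  refine subequiv_of_map (fun i : Fin (a.len + b.len) => (finAddFlip i : Fin (b.len + a.len)))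
    ?_ (fun i j h h' => absurd (finAddFlip.injective h') h)
  intro i
  change Fin (a.len + b.len) at i
  induction i using Fin.addCases with
  | left i => simp [append]
  | right i => simp [append]

theorem append_assoc_subequiv (a b c : OpenTuple X) :
    Subequiv Γ ((a.append b).append c) (a.append (b.append c)) ∧
      Subequiv Γ (a.append (b.append c)) ((a.append b).append c) := by
  have h : ((a.append b).append c).len = (a.append (b.append c)).len := Nat.add_assoc _ _ _
  have hs : ((a.append b).append c).sets = (a.append (b.append c)).sets ∘ Fin.cast h := by
    exact Fin.append_assoc _ _ _
  constructor
  · refine subequiv_of_map (Fin.cast h) (fun i => by rw [hs]; rfl)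
      (fun i j hij h' => absurd (Fin.cast_injective _ h') hij)
  · refine subequiv_of_map (Fin.cast h.symm) (fun i => by rw [hs]; rfl)
      (fun i j hij h' => absurd (Fin.cast_injective _ h') hij)

theorem append_empty_subequiv (a : OpenTuple X) :
    Subequiv Γ (a.append empty) a ∧ Subequiv Γ a (a.append empty) := by
  have hl : ∀ i : Fin a.len, (a.append empty).sets (Fin.castAdd 1 i) = a.sets i :=
    fun i => Fin.append_left _ _ i
  have hr : ∀ i : Fin 1, (a.append empty).sets (Fin.natAdd a.len i) = ⊥ :=
    fun i => Fin.append_right _ _ i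
  have hr' : ∀ i : Fin 1, ((a.append empty).sets (Fin.natAdd a.len i) : Set X) = ∅ :=
    fun i => by rw [hr]; rfl
  constructor
  · let f : Fin (a.len + 1) → Fin a.len := Fin.addCases id (fun _ => ⟨0, a.len_pos⟩)
    have fl : ∀ i, f (Fin.castAdd 1 i) = i := fun i => by simp [f]
    refine subequiv_of_map (a := a.append empty) (b := a) f
      (fun i => ?_) (fun i j hij hf => ?_)
    · change Fin (a.len + 1) at i
      induction i using Fin.addCases with
      | left i => rw [hl, fl]
      | right i => exact (hr i).le.trans bot_le
    · change Fin (a.len + 1) at i j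
      induction i using Fin.addCases with
      | left i =>
        induction j using Fin.addCases with
        | left j =>
          rw [fl, fl] at hf
          exact absurd (congrArg _ hf) hij
        | right j => exact (Set.disjoint_empty _).mono_right (hr' j).le
      | right i => exact (Set.empty_disjoint _).mono_left (hr' i).le
  · exact subequiv_of_map (a := a) (b := a.append empty) (Fin.castAdd 1) (fun i => (hl i).ge)
      (fun i j hij h' => absurd (Fin.castAdd_injective _ _ h') hij)

theorem exists_strictlyInside [ContinuousConstSMul Γ X] [T2Space X] [LocallyCompactSpace X]
    {a b c : OpenTuple X} (hca : StrictlyInside c a) (hab : Subequiv Γ a b) :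
    ∃ d, Subequiv Γ c d ∧ StrictlyInside d b := by
  obtain ⟨h, hc⟩ := hca
  obtain ⟨nc, hnc, C⟩ := c
  obtain ⟨na, hna, A⟩ := a
  obtain rfl : nc = na := h
  simp only [Fin.cast_eq_self] at hc
  obtain ⟨J, U, s, k, h1, h2, h3⟩ := hab (fun i => closure (C i : Set X)) hc
  obtain ⟨G, hG, hFG⟩ := exists_compact_levels (fun i => (hc i).1) s k b.sets h1 h2
  have key : ∀ l, ∃ D : Opens X, G l ⊆ D ∧ closure (D : Set X) ⊆ b.sets l ∧
      IsCompact (closure (D : Set X)) := by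
    intro l
    obtain ⟨D, hD, h1, h2, h3⟩ :=
      exists_open_between_and_isCompact_closure (hG l).1 (b.sets l).isOpen (hG l).2
    exact ⟨⟨D, hD⟩, h1, h2, h3⟩
  choose D hGD hDb hDc using key
  refine ⟨⟨b.len, b.len_pos, D⟩, ?_, rfl, fun l => ⟨hDc l, hDb l⟩⟩
  intro F hF
  refine ⟨J, fun i j => ⟨(U i j : Set X) ∩ (fun x => s i j • x) ⁻¹' (D (k i j) : Set X),
      (U i j).isOpen.inter ((D (k i j)).isOpen.preimage (continuous_const_smul _))⟩, s, k,
      ?_, ?_, ?_⟩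
  · intro i x hx
    obtain ⟨j, hj, hjG⟩ := hFG i x (subset_closure ((hF i).2 hx))
    exact Set.mem_iUnion.2 ⟨j, hj, hGD _ hjG⟩
  · rintro i j _ ⟨x, ⟨-, hx⟩, rfl⟩
    exact hx
  · intro p q hpq hk
    exact (h3 p q hpq hk).mono (Set.smul_set_mono Set.inter_subset_left)
      (Set.smul_set_mono Set.inter_subset_left)

theorem Prec.mono [ContinuousConstSMul Γ X] [T2Space X] [LocallyCompactSpace X]
    {a a' b b' : OpenTuple X} (ha : Subequiv Γ a' a) (h : Prec Γ a b)
    (hb : Subequiv Γ b b') : Prec Γ a' b' := by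
  obtain ⟨c, hac, hcb⟩ := h
  obtain ⟨d, hcd, hdb⟩ := exists_strictlyInside hcb hb
  exact ⟨d, (ha.trans hac).trans hcd, hdb⟩

variable (X Γ)

/-- The equivalence relation `a ≈ b`, that is, `a ≼ b` and `b ≼ a`. -/
def setoid [ContinuousConstSMul Γ X] [T2Space X] : Setoid (OpenTuple X) where
  r a b := Subequiv Γ a b ∧ Subequiv Γ b a
  iseqv :=
    { refl := fun a => ⟨Subequiv.refl a, Subequiv.refl a⟩
      symm := fun h => ⟨h.2, h.1⟩
      trans := fun h h' => ⟨h.1.trans h'.1, h'.2.trans h.2⟩ }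

end OpenTuple

/-- The generalized type semigroup `W(X, Γ)`. -/
def GenTypeSemigroup (X : Type u) (Γ : Type v) [TopologicalSpace X] [T2Space X] [Group Γ]
    [MulAction Γ X] [ContinuousConstSMul Γ X] : Type u :=
  Quotient (OpenTuple.setoid X Γ)

namespace GenTypeSemigroup

variable (X : Type u) (Γ : Type v) [TopologicalSpace X] [T2Space X] [Group Γ]
    [MulAction Γ X] [ContinuousConstSMul Γ X]

/-- Addition is induced by concatenation. -/
instance instAdd : Add (GenTypeSemigroup X Γ) where
  add := Quotient.map₂ OpenTuple.append fun _ _ ha _ _ hb =>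
    ⟨OpenTuple.subequiv_append ha.1 hb.1, OpenTuple.subequiv_append ha.2 hb.2⟩

/-- Zero is the class of the empty set. -/
instance instZero : Zero (GenTypeSemigroup X Γ) where
  zero := Quotient.mk (OpenTuple.setoid X Γ) OpenTuple.empty

instance instAddCommMonoid : AddCommMonoid (GenTypeSemigroup X Γ) where
  add_assoc := by
    rintro ⟨a⟩ ⟨b⟩ ⟨c⟩
    exact Quotient.sound (s := OpenTuple.setoid X Γ) (OpenTuple.append_assoc_subequiv a b c)
  zero_add := by
    rintro ⟨a⟩
    exact Quotient.sound (s := OpenTuple.setoid X Γ)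
      ⟨(OpenTuple.append_comm_subequiv _ _).trans (OpenTuple.append_empty_subequiv a).1,
        (OpenTuple.append_empty_subequiv a).2.trans (OpenTuple.append_comm_subequiv _ _)⟩
  add_zero := by
    rintro ⟨a⟩
    exact Quotient.sound (s := OpenTuple.setoid X Γ) (OpenTuple.append_empty_subequiv a)
  add_comm := by
    rintro ⟨a⟩ ⟨b⟩
    exact Quotient.sound (s := OpenTuple.setoid X Γ)
      ⟨OpenTuple.append_comm_subequiv a b, OpenTuple.append_comm_subequiv b a⟩
  nsmul := nsmulRec

/-- The order is induced by `≼`. -/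
instance instPartialOrder : PartialOrder (GenTypeSemigroup X Γ) where
  le := Quotient.lift₂ (OpenTuple.Subequiv Γ) fun _ _ _ _ ha hb => propext
    ⟨fun h => (ha.2.trans h).trans hb.1, fun h => (ha.1.trans h).trans hb.2⟩
  le_refl := by
    rintro ⟨a⟩
    exact OpenTuple.Subequiv.refl a
  le_trans := by
    rintro ⟨a⟩ ⟨b⟩ ⟨c⟩ hab hbc
    exact OpenTuple.Subequiv.trans hab hbc
  le_antisymm := by
    rintro ⟨a⟩ ⟨b⟩ hab hba
    exact Quotient.sound (s := OpenTuple.setoid X Γ) ⟨hab, hba⟩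

/-- The relation on `W(X, Γ)` induced by `≺`. -/
def Prec [LocallyCompactSpace X] : GenTypeSemigroup X Γ → GenTypeSemigroup X Γ → Prop :=
  Quotient.lift₂ (OpenTuple.Prec Γ) fun _ _ _ _ ha hb => propext
    ⟨fun h => OpenTuple.Prec.mono ha.2 h hb.1, fun h => OpenTuple.Prec.mono ha.1 h hb.2⟩

end GenTypeSemigroup

/-- `X` is zero-dimensional: its compact open sets form a basis of the topology. -/
def HasCompactOpenBasis (X : Type u) [TopologicalSpace X] : Prop :=
  IsTopologicalBasis {U : Set X | IsOpen U ∧ IsCompact U}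

/-! A class `x` in the completion is determined by `below x`, the set of elements of `S` that are
`r`-below some term of a representing sequence. Such sets are downward closed and `r`-directed, and
have a countable cofinal sequence; conversely, every set of this kind occurs (`exists_below_eq`).
Order becomes inclusion and suprema of increasing sequences become unions, so (O1)-(O4) can be read
off once `S` is mapped into the completion by `principal`, which is additive by (W3) and (W4). (O6)
follows from a single use of (W6), whereas (O5) needs (W5) iterated along a sequence
(`exists_complement_seq`).

For open tuples, (W1)-(W4) express that open sets are exhausted by relatively compact open subsets.
(W6) holds because the pieces of an embedding of `a` into a concatenation can be sorted by the half
in which they land (`exists_decomposition`). In the zero-dimensional case, compact open tuples can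
be inserted between tuples related by `≺`. Compact open pieces can be cut to be disjoint, and what
an embedded copy of `a` leaves free in `c` is again compact open; this gives an exact complement
(`exists_complement`), hence (W5). -/

namespace IsWSemigroup

variable {S : Type u} [AddCommMonoid S] [PartialOrder S] {r : S → S → Prop}

theorem rel_of_le_of_rel (h : IsWSemigroup S r) {a b c : S} (hab : a ≤ b) (hbc : r b c) : r a c :=
  h.auxiliary.rel_of_le_of_rel_of_le a b c c hab hbc le_rfl

theorem rel_of_rel_of_le (h : IsWSemigroup S r) {a b c : S} (hab : r a b) (hbc : b ≤ c) : r a c :=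
  h.auxiliary.rel_of_le_of_rel_of_le a a b c le_rfl hab hbc

theorem exists_between (h : IsWSemigroup S r) {a c : S} (hac : r a c) : ∃ b, r a b ∧ r b c := by
  obtain ⟨x, hx, -, hc⟩ := h.w1 c
  obtain ⟨k, hk⟩ := hc a hac
  exact ⟨x k, hk, hx k⟩

end IsWSemigroup

/-! ### The completion as a family of ideals, and the axioms (O1)-(O6). -/

namespace CuCompletion

variable {S : Type u} [AddCommMonoid S] [PartialOrder S] {r : S → S → Prop}
  {h : IsWSemigroup S r}

/-- The elements of `S` that are `r`-below some term of a sequence representing `x`. -/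
def below (x : CuCompletion h) : Set S :=
  Quotient.lift (s := RapidSeq.setoid h) (fun x : RapidSeq r => {a | ∃ n, r a (x.1 n)})
    (fun x y (hxy : RapidSeq.Le x y ∧ RapidSeq.Le y x) => by
      ext a
      constructor
      · rintro ⟨n, hn⟩
        obtain ⟨m, hm⟩ := hxy.1 n
        exact ⟨m, h.rel_trans hn hm⟩
      · rintro ⟨n, hn⟩
        obtain ⟨m, hm⟩ := hxy.2 n
        exact ⟨m, h.rel_trans hn hm⟩) x

theorem le_iff {x y : CuCompletion h} : x ≤ y ↔ below x ⊆ below y := by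
  obtain ⟨x⟩ := x
  obtain ⟨y⟩ := y
  constructor
  · rintro hxy a ⟨n, hn⟩
    obtain ⟨m, hm⟩ := hxy n
    exact ⟨m, h.rel_trans hn hm⟩
  · exact fun hxy k => hxy ⟨k + 1, x.2 k⟩

theorem mem_below_of_le {x : CuCompletion h} {a b : S} (hab : a ≤ b) (hb : b ∈ below x) :
    a ∈ below x := by
  obtain ⟨x⟩ := x
  obtain ⟨n, hn⟩ := hb
  exact ⟨n, h.rel_of_le_of_rel hab hn⟩

theorem mem_below_of_rel {x : CuCompletion h} {a b : S} (hab : r a b) (hb : b ∈ below x) :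
    a ∈ below x :=
  mem_below_of_le (h.auxiliary.le_of_rel a b hab) hb

/-- Directedness and roundness at once: a late enough term of the sequence dominates both elements.
With `a = b` it gives interpolation inside `below x`. -/
theorem exists_rel_mem_below {x : CuCompletion h} {a b : S} (ha : a ∈ below x)
    (hb : b ∈ below x) : ∃ c ∈ below x, r a c ∧ r b c := by
  obtain ⟨x⟩ := x
  obtain ⟨n, hn⟩ := ha
  obtain ⟨m, hm⟩ := hb
  exact ⟨x.1 (max n m), ⟨max n m + 1, x.2 _⟩, x.rel_of_rel_of_le h hn (le_max_left n m),
    x.rel_of_rel_of_le h hm (le_max_right n m)⟩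

theorem mem_below_add {x y : CuCompletion h} {c : S} :
    c ∈ below (x + y) ↔ ∃ a ∈ below x, ∃ b ∈ below y, r c (a + b) := by
  obtain ⟨x⟩ := x
  obtain ⟨y⟩ := y
  constructor
  · rintro ⟨n, hn⟩
    exact ⟨x.1 n, ⟨n + 1, x.2 n⟩, y.1 n, ⟨n + 1, y.2 n⟩, hn⟩
  · rintro ⟨a, ⟨n, hn⟩, b, ⟨m, hm⟩, hc⟩
    exact ⟨max n m, h.rel_trans hc (h.w3 _ _ _ _ (x.rel_of_rel_of_le h hn (le_max_left n m))
      (y.rel_of_rel_of_le h hm (le_max_right n m)))⟩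

theorem add_mem_below_add {x y : CuCompletion h} {a b : S} (ha : a ∈ below x)
    (hb : b ∈ below y) : a + b ∈ below (x + y) := by
  obtain ⟨a', ha', haa', -⟩ := exists_rel_mem_below ha ha
  obtain ⟨b', hb', hbb', -⟩ := exists_rel_mem_below hb hb
  exact mem_below_add.2 ⟨a', ha', b', hb', h.w3 _ _ _ _ haa' hbb'⟩

/-- The cofinal sequence `b` need not be increasing; directedness of `I` lets a new sequence climb
past its terms one by one. -/
theorem exists_below_eq (I : Set S) (b : ℕ → S) (hb : ∀ n, b n ∈ I)
    (hI : ∀ a ∈ I, ∃ n, r a (b n)) (hdown : ∀ a, ∀ c ∈ I, r a c → a ∈ I)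
    (hdir : ∀ p ∈ I, ∀ q ∈ I, ∃ z ∈ I, r p z ∧ r q z) :
    ∃ x : CuCompletion h, below x = I := by
  choose f hfI hf₁ hf₂ using fun (p q : I) => hdir p.1 p.2 q.1 q.2
  -- The term `y (k + 1)` dominates both `y k` and `b k`: the first makes `y` rapid, the second
  -- makes it cofinal.
  let y : ℕ → I := fun n => Nat.rec ⟨b 0, hb 0⟩ (fun k p => ⟨f p ⟨b k, hb k⟩, hfI _ _⟩) n
  refine ⟨Quotient.mk (RapidSeq.setoid h) ⟨fun n => (y n).1, fun k => hf₁ (y k) _⟩, ?_⟩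
  ext a
  constructor
  · rintro ⟨n, hn⟩
    exact hdown a _ (y n).2 hn
  · intro ha
    obtain ⟨n, hn⟩ := hI a ha
    exact ⟨n + 1, h.rel_trans hn (hf₂ (y n) ⟨b n, hb n⟩)⟩

theorem exists_principal (a : S) : ∃ x : CuCompletion h, below x = {b | r b a} := by
  obtain ⟨x, hxa, hx, ha⟩ := h.w1 a
  refine ⟨Quotient.mk (RapidSeq.setoid h) ⟨x, hx⟩, ?_⟩
  ext b
  exact ⟨fun ⟨n, hn⟩ => h.rel_trans hn (hxa n), ha b⟩

variable (h) in
/-- The element of the completion that corresponds to `a`. -/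
noncomputable def principal (a : S) : CuCompletion h := (exists_principal a).choose

theorem mem_below_principal {a b : S} : b ∈ below (principal h a) ↔ r b a :=
  Set.ext_iff.1 (exists_principal (h := h) a).choose_spec b

theorem principal_le_of_mem {x : CuCompletion h} {a : S} (ha : a ∈ below x) :
    principal h a ≤ x :=
  le_iff.2 fun _ hb => mem_below_of_rel (mem_below_principal.1 hb) ha

theorem principal_mono {a b : S} (hab : a ≤ b) : principal h a ≤ principal h b :=
  le_iff.2 fun _ hc => mem_below_principal.2 (h.rel_of_rel_of_le (mem_below_principal.1 hc) hab)

/-- One inequality is (W4), the other (W3). -/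
theorem principal_add (a b : S) : principal h (a + b) = principal h a + principal h b := by
  apply le_antisymm
  · refine le_iff.2 fun c hc => ?_
    obtain ⟨a', b', hc, ha, hb⟩ := h.w4 c a b (mem_below_principal.1 hc)
    exact mem_below_add.2 ⟨a', mem_below_principal.2 ha, b', mem_below_principal.2 hb, hc⟩
  · refine le_iff.2 fun c hc => ?_
    obtain ⟨a', ha, b', hb, hc⟩ := mem_below_add.1 hc
    exact mem_below_principal.2 (h.rel_trans hc
      (h.w3 _ _ _ _ (mem_below_principal.1 ha) (mem_below_principal.1 hb)))

theorem isLUB_of_below_eq {x : ℕ → CuCompletion h} {s : CuCompletion h}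
    (hs : below s = ⋃ n, below (x n)) : IsLUB (Set.range x) s := by
  constructor
  · rintro _ ⟨n, rfl⟩
    exact le_iff.2 (hs ▸ Set.subset_iUnion (fun n => below (x n)) n)
  · intro t ht
    rw [le_iff, hs]
    exact Set.iUnion_subset fun n => le_iff.1 (ht ⟨n, rfl⟩)

/-- An increasing union of these ideals is directed, and pairing indices turns the countably many
cofinal sequences into one. -/
theorem exists_below_eq_iUnion {x : ℕ → CuCompletion h} (hx : Monotone x) :
    ∃ s : CuCompletion h, below s = ⋃ n, below (x n) := by
  have hrep : ∀ n, ∃ y : ℕ → S, below (x n) = {a | ∃ m, r a (y m)} ∧ ∀ m, y m ∈ below (x n) := by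
    intro n
    obtain ⟨y, hy⟩ := Quotient.exists_rep (x n)
    rw [← hy]
    exact ⟨y.1, rfl, fun m => ⟨m + 1, y.2 m⟩⟩
  choose y hy hyx using hrep
  refine exists_below_eq _ (fun n => y n.unpair.1 n.unpair.2)
    (fun n => Set.mem_iUnion.2 ⟨_, hyx _ _⟩) ?_ ?_ ?_
  · intro a ha
    obtain ⟨n, hn⟩ := Set.mem_iUnion.1 ha
    rw [hy n] at hn
    obtain ⟨m, hm⟩ := hn
    exact ⟨Nat.pair n m, by simpa using hm⟩
  · intro a c hc hac
    obtain ⟨n, hn⟩ := Set.mem_iUnion.1 hc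
    exact Set.mem_iUnion.2 ⟨n, mem_below_of_rel hac hn⟩
  · intro p hp q hq
    obtain ⟨n, hn⟩ := Set.mem_iUnion.1 hp
    obtain ⟨m, hm⟩ := Set.mem_iUnion.1 hq
    obtain ⟨z, hz, h'⟩ := exists_rel_mem_below
      (le_iff.1 (hx (le_max_left n m)) hn) (le_iff.1 (hx (le_max_right n m)) hm)
    exact ⟨z, Set.mem_iUnion.2 ⟨_, hz⟩, h'⟩

theorem below_eq_of_isLUB {x : ℕ → CuCompletion h} (hx : Monotone x) {s : CuCompletion h}
    (hs : IsLUB (Set.range x) s) : below s = ⋃ n, below (x n) := by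
  obtain ⟨t, ht⟩ := exists_below_eq_iUnion hx
  rw [hs.unique (isLUB_of_below_eq ht), ht]

/-- Since a supremum is a union of ideals, the single element `a` already lies in one of them.
Together with `exists_le_principal` this reduces way-below in the completion to membership in
`below`. -/
theorem wayBelow_principal {x : CuCompletion h} {a : S} (ha : a ∈ below x) :
    WayBelow (principal h a) x := by
  intro y s hy hs hxs
  have := le_iff.1 hxs ha
  rw [below_eq_of_isLUB hy hs] at this
  obtain ⟨m, hm⟩ := Set.mem_iUnion.1 this
  exact ⟨m, principal_le_of_mem hm⟩

theorem exists_principal_seq (x : CuCompletion h) :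
    ∃ a : ℕ → S, (∀ n, r (a n) (a (n + 1))) ∧ (∀ n, a n ∈ below x) ∧
      IsLUB (Set.range fun n => principal h (a n)) x := by
  obtain ⟨x⟩ := x
  refine ⟨x.1, x.2, fun n => ⟨n + 1, x.2 n⟩, isLUB_of_below_eq ?_⟩
  ext a
  simp only [Set.mem_iUnion, mem_below_principal]
  rfl

theorem exists_le_principal {x y : CuCompletion h} (hxy : WayBelow x y) :
    ∃ a ∈ below y, x ≤ principal h a := by
  obtain ⟨a, ha, hay, hlub⟩ := exists_principal_seq y
  obtain ⟨m, hm⟩ := hxy _ y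
    (monotone_nat_of_le_succ fun n => principal_mono (h.auxiliary.le_of_rel _ _ (ha n))) hlub le_rfl
  exact ⟨a m, hay m, hm⟩

theorem add_le_add {x x' y y' : CuCompletion h} (hx : x ≤ x') (hy : y ≤ y') :
    x + y ≤ x' + y' := by
  refine le_iff.2 fun c hc => ?_
  obtain ⟨a, ha, b, hb, hc⟩ := mem_below_add.1 hc
  exact mem_below_add.2 ⟨a, le_iff.1 hx ha, b, le_iff.1 hy hb, hc⟩

variable (h) in
theorem isPositivelyOrdered : IsPositivelyOrdered (CuCompletion h) where
  add_le_add_right _ _ _ hab := add_le_add hab le_rfl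
  zero_le := by
    rintro ⟨x⟩
    exact fun _ => ⟨0, h.auxiliary.zero_rel _⟩

variable (h) in
theorem isCuSemigroup : IsCuSemigroup (CuCompletion h) where
  positivelyOrdered := isPositivelyOrdered h
  o1 x hx := by
    obtain ⟨s, hs⟩ := exists_below_eq_iUnion hx
    exact ⟨s, isLUB_of_below_eq hs⟩
  o2 x := by
    obtain ⟨a, ha, -, hlub⟩ := exists_principal_seq x
    exact ⟨_, fun k => wayBelow_principal (mem_below_principal.2 (ha k)), hlub⟩
  o3 x' x y' y hx hy := by
    obtain ⟨a, ha, hxa⟩ := exists_le_principal hx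
    obtain ⟨b, hb, hyb⟩ := exists_le_principal hy
    intro z s hz hs hxys
    obtain ⟨m, hm⟩ := wayBelow_principal (add_mem_below_add ha hb) z s hz hs hxys
    exact ⟨m, ((add_le_add hxa hyb).trans (principal_add a b).ge).trans hm⟩
  o4 x y s t hx hy hs ht := by
    apply isLUB_of_below_eq
    ext c
    simp only [Set.mem_iUnion, mem_below_add, below_eq_of_isLUB hx hs, below_eq_of_isLUB hy ht]
    constructor
    · rintro ⟨a, ⟨n, hn⟩, b, ⟨m, hm⟩, hc⟩
      exact ⟨max n m, a, le_iff.1 (hx (le_max_left n m)) hn, b,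
        le_iff.1 (hy (le_max_right n m)) hm, hc⟩
    · rintro ⟨n, a, ha, b, hb, hc⟩
      exact ⟨a, ⟨n, ha⟩, b, ⟨n, hb⟩, hc⟩

variable (h) in
theorem axiomO6 (h6 : AxiomW6 r) : AxiomO6 (CuCompletion h) := by
  intro x' x y z hx hxyz
  obtain ⟨a', ha', hxa'⟩ := exists_le_principal hx
  obtain ⟨a, ha, haa, -⟩ := exists_rel_mem_below ha' ha'
  obtain ⟨b, hb, c, hc, habc⟩ := mem_below_add.1 (le_iff.1 hxyz ha)
  obtain ⟨e, f, hef, hea, heb, hfa, hfc⟩ := h6 a' a b c haa habc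
  refine ⟨principal h e, principal h f, ?_, principal_le_of_mem (mem_below_of_rel hea ha),
    principal_le_of_mem (mem_below_of_rel heb hb), principal_le_of_mem (mem_below_of_rel hfa ha),
    principal_le_of_mem (mem_below_of_rel hfc hc)⟩
  rw [← principal_add]
  exact hxa'.trans (principal_mono (h.auxiliary.le_of_rel _ _ hef))

/-- (W5) yields a complement relative to one pair `z n`, `z (n + 1)`. Feeding that complement back
in as the second summand for the next pair makes the successive complements increase. -/
theorem exists_complement_seq (h : IsWSemigroup S r) (h5 : AxiomW5 r) {a' a b' b : S} {z : ℕ → S}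
    (hz : ∀ n, r (z n) (z (n + 1))) (ha : r a' a) (hb : r b' b) (hab : r (a + b) (z 0)) :
    ∃ w : ℕ → S, (∀ n, r (w n) (w (n + 1))) ∧ r b' (w 0) ∧
      (∀ n, r (a' + w n) (z n)) ∧ ∀ n, r (z n) (a + w (n + 1)) := by
  -- The state is `(d, x', x)`: `d` is the current first summand, and `x'`, `x` are the current
  -- complement and its enlargement. Each use of (W5) shrinks `d`, so `d` must stay strictly above
  -- `a'` to leave room for the next.
  let Q : ℕ → S × S × S → Prop := fun n p =>
    r a' p.1 ∧ p.1 ≤ a ∧ r p.2.1 p.2.2 ∧ r (p.1 + p.2.2) (z n)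
  have step : ∀ n (p : {p // Q n p}), ∃ q : {p // Q (n + 1) p},
      r p.1.2.1 q.1.2.1 ∧ r (z n) (a + q.1.2.1) := by
    rintro n ⟨⟨d, x', x⟩, hd, hda, hx, hdx⟩
    obtain ⟨e, hae, hed⟩ := h.exists_between hd
    obtain ⟨y', y, h1, h2, h3, h4⟩ := h5 e d x' x (z n) (z (n + 1)) hdx hed hx (hz n)
    exact ⟨⟨(e, y', y), hae, (h.auxiliary.le_of_rel _ _ hed).trans hda, h4, h1⟩, h3,
      h.rel_of_rel_of_le h2 (h.positivelyOrdered.add_le_add_right _ _ _ hda)⟩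
  obtain ⟨b₁, hb₁, hbb₁⟩ := h.exists_between hb
  choose g hg₁ hg₂ using step
  let p : ∀ n, {p // Q n p} := fun n =>
    Nat.rec (motive := fun n => {p // Q n p}) ⟨(a, b₁, b), ha, le_rfl, hbb₁, hab⟩ g n
  refine ⟨fun n => (p n).1.2.1, fun n => hg₁ n (p n), hb₁, fun n => ?_, fun n => hg₂ n (p n)⟩
  obtain ⟨hd, -, hx, hdx⟩ := (p n).2
  exact h.rel_trans (h.w3 _ _ _ _ hd hx) hdx

variable (h) in
theorem axiomO5 (h5 : AxiomW5 r) : AxiomO5 (CuCompletion h) := by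
  rintro x' x y' y z hxyz hx hy
  obtain ⟨a', ha', hxa'⟩ := exists_le_principal hx
  obtain ⟨b', hb', hyb'⟩ := exists_le_principal hy
  obtain ⟨a, ha, haa, -⟩ := exists_rel_mem_below ha' ha'
  obtain ⟨b, hb, hbb, -⟩ := exists_rel_mem_below hb' hb'
  obtain ⟨z⟩ := z
  obtain ⟨N, hN⟩ := le_iff.1 hxyz (add_mem_below_add ha hb)
  -- Dropping the first `N` terms puts `a + b` below the initial term without changing the class of
  -- `z`.
  obtain ⟨w, hw, hbw, hwz, hzw⟩ := exists_complement_seq h h5 (z := fun n => z.1 (N + n))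
    (fun n => z.2 (N + n)) haa hbb hN
  refine ⟨Quotient.mk (RapidSeq.setoid h) ⟨w, hw⟩, ?_, ?_,
    hyb'.trans (principal_le_of_mem ⟨0, hbw⟩)⟩
  · refine (add_le_add hxa' le_rfl).trans (le_iff.2 fun c hc => ?_)
    obtain ⟨d, hd, e, ⟨n, he⟩, hc⟩ := mem_below_add.1 hc
    exact ⟨N + n, h.rel_trans (h.rel_trans hc (h.w3 _ _ _ _ (mem_below_principal.1 hd) he))
      (hwz n)⟩
  · refine le_iff.2 ?_
    rintro c ⟨n, hc⟩
    exact mem_below_add.2 ⟨a, ha, w (n + 1), ⟨n + 2, hw _⟩,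
      h.rel_trans (z.rel_of_rel_of_le h hc (Nat.le_add_left n N)) (hzw n)⟩

end CuCompletion

/-! ### Tuples of open sets: pieces, interpolation, exhaustion, decomposition. -/

namespace OpenTuple

variable {X : Type u} {Γ : Type v} [TopologicalSpace X] [Group Γ] [MulAction Γ X]

/-- One finite family covering the open sets themselves serves all compact subsets simultaneously. A
single index type, with `lev` recording the source level, avoids dependent indices. -/
theorem subequiv_of_pieces {a b : OpenTuple X} {P : Type} [Fintype P] (lev : P → Fin a.len)
    (W : P → Opens X) (t : P → Γ) (m : P → Fin b.len)
    (h1 : ∀ i, ∀ x ∈ a.sets i, ∃ p, lev p = i ∧ x ∈ W p)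
    (h2 : ∀ p, t p • (W p : Set X) ⊆ (b.sets (m p) : Set X))
    (h3 : ∀ p q, p ≠ q → m p = m q → Disjoint (t p • (W p : Set X)) (t q • (W q : Set X))) :
    Subequiv Γ a b := by
  classical
  intro F hF
  refine subequiv_aux (ι := fun i => {p : P // lev p = i}) (fun _ p => W p.1) (fun _ p => t p.1)
    (fun _ p => m p.1) (fun i x hx => ?_) (fun _ p => h2 p.1) ?_
  · obtain ⟨p, hp, hxp⟩ := h1 i x ((hF i).2 hx)
    exact Set.mem_iUnion.2 ⟨⟨p, hp⟩, hxp⟩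
  · rintro ⟨_, p, rfl⟩ ⟨_, q, rfl⟩ hne hk
    refine h3 p q (fun h => hne ?_) hk
    subst h
    rfl

theorem append_sets_left (a b : OpenTuple X) (i : Fin a.len) :
    (a.append b).sets (Fin.castAdd b.len i) = a.sets i :=
  Fin.append_left _ _ i

theorem append_sets_right (a b : OpenTuple X) (i : Fin b.len) :
    (a.append b).sets (Fin.natAdd a.len i) = b.sets i :=
  Fin.append_right _ _ i

theorem subequiv_of_le {n : ℕ} (hn : 0 < n) {A B : Fin n → Opens X} (h : ∀ i, A i ≤ B i) :
    Subequiv Γ ⟨n, hn, A⟩ ⟨n, hn, B⟩ :=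
  subequiv_of_map id h fun _ _ h h' => absurd h' h

theorem StrictlyInside.exists_sets {c a : OpenTuple X} (h : StrictlyInside c a) :
    ∃ C : Fin a.len → Opens X, c = ⟨a.len, a.len_pos, C⟩ ∧
      ∀ i, IsCompact (closure (C i : Set X)) ∧ closure (C i : Set X) ⊆ (a.sets i : Set X) := by
  obtain ⟨nc, hnc, C⟩ := c
  obtain ⟨na, hna, A⟩ := a
  obtain ⟨h, hc⟩ := h
  obtain rfl : nc = na := h
  exact ⟨C, rfl, hc⟩

theorem StrictlyInside.subequiv {c a : OpenTuple X} (h : StrictlyInside c a) :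
    Subequiv Γ c a := by
  obtain ⟨C, rfl, hC⟩ := h.exists_sets
  exact subequiv_of_le _ fun i => subset_closure.trans (hC i).2

theorem StrictlyInside.prec {c a : OpenTuple X} (h : StrictlyInside c a) : Prec Γ c a :=
  ⟨c, Subequiv.refl c, h⟩

theorem StrictlyInside.exists_between [LocallyCompactSpace X] [T2Space X] {c a : OpenTuple X}
    (h : StrictlyInside c a) : ∃ d, StrictlyInside c d ∧ StrictlyInside d a := by
  obtain ⟨C, rfl, hC⟩ := h.exists_sets
  have key : ∀ i, ∃ D : Opens X, closure (C i : Set X) ⊆ D ∧ closure (D : Set X) ⊆ a.sets i ∧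
      IsCompact (closure (D : Set X)) := by
    intro i
    obtain ⟨D, hD, h⟩ :=
      exists_open_between_and_isCompact_closure (hC i).1 (a.sets i).isOpen (hC i).2
    exact ⟨⟨D, hD⟩, h⟩
  choose D h1 h2 h3 using key
  exact ⟨⟨a.len, a.len_pos, D⟩, ⟨rfl, fun i => ⟨(hC i).1, h1 i⟩⟩, ⟨rfl, fun i => ⟨h3 i, h2 i⟩⟩⟩

theorem StrictlyInside.append {a a' b b' : OpenTuple X} (ha : StrictlyInside a' a)
    (hb : StrictlyInside b' b) : StrictlyInside (a'.append b') (a.append b) := by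
  obtain ⟨A, rfl, hA⟩ := ha.exists_sets
  obtain ⟨B, rfl, hB⟩ := hb.exists_sets
  refine ⟨rfl, fun i => ?_⟩
  change Fin (a.len + b.len) at i
  induction i using Fin.addCases with
  | left i => simpa [OpenTuple.append] using hA i
  | right i => simpa [OpenTuple.append] using hB i

theorem StrictlyInside.exists_append {a b c : OpenTuple X}
    (h : StrictlyInside c (a.append b)) :
    ∃ a' b', c = a'.append b' ∧ StrictlyInside a' a ∧ StrictlyInside b' b := by
  obtain ⟨C, rfl, hC⟩ := h.exists_sets
  change Fin (a.len + b.len) → Opens X at C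
  refine ⟨⟨a.len, a.len_pos, fun i => C (Fin.castAdd b.len i)⟩,
    ⟨b.len, b.len_pos, fun i => C (Fin.natAdd a.len i)⟩, ?_, ⟨rfl, fun i => ?_⟩,
    ⟨rfl, fun i => ?_⟩⟩
  · simp only [OpenTuple.append, Fin.append_castAdd_natAdd]
  · simpa [append_sets_left] using hC (Fin.castAdd b.len i)
  · simpa [append_sets_right] using hC (Fin.natAdd a.len i)

/-- Interiors of a compact exhaustion of the subspace `O` are open in `X`, and their closures stay
inside the compact, hence closed, members of the exhaustion. -/
theorem exists_open_exhaustion [LocallyCompactSpace X] [T2Space X] [SecondCountableTopology X]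
    (O : Opens X) : ∃ V : ℕ → Opens X, Monotone V ∧
      (∀ k, IsCompact (closure (V k : Set X)) ∧ closure (V k : Set X) ⊆ V (k + 1)) ∧
      (∀ k, closure (V k : Set X) ⊆ O) ∧ ∀ K ⊆ (O : Set X), IsCompact K → ∃ k, K ⊆ V k := by
  have : LocallyCompactSpace O := O.isOpen.locallyCompactSpace
  let E : CompactExhaustion O := default
  have hE : ∀ k, IsCompact (Subtype.val '' E k : Set X) :=
    fun k => (E.isCompact k).image continuous_subtype_val
  let V : ℕ → Opens X := fun k =>
    ⟨Subtype.val '' interior (E k), O.isOpen.isOpenMap_subtype_val _ isOpen_interior⟩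
  have hcl : ∀ k, closure (V k : Set X) ⊆ Subtype.val '' E k := fun k =>
    closure_minimal (Set.image_mono interior_subset) (hE k).isClosed
  have hV : ∀ k, closure (V k : Set X) ⊆ V (k + 1) := fun k =>
    (hcl k).trans (Set.image_mono (E.subset_interior_succ k))
  have hmono : Monotone V := monotone_nat_of_le_succ fun k => subset_closure.trans (hV k)
  refine ⟨V, hmono, fun k => ⟨(hE k).of_isClosed_subset isClosed_closure (hcl k), hV k⟩,
    fun k => (hcl k).trans (by rintro _ ⟨x, -, rfl⟩; exact x.2), fun K hKO hK => ?_⟩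
  refine hK.elim_directed_cover (fun k => (V k : Set X)) (fun k => (V k).isOpen)
    (fun x hx => ?_) (hmono.directed_le)
  obtain ⟨n, hn⟩ := E.exists_mem ⟨x, hKO hx⟩
  exact Set.mem_iUnion.2 ⟨n + 1, ⟨x, hKO hx⟩, E.subset_interior_succ n hn, rfl⟩

theorem exists_exhaustion [LocallyCompactSpace X] [T2Space X] [SecondCountableTopology X]
    (a : OpenTuple X) : ∃ V : ℕ → Fin a.len → Opens X,
      (∀ k, StrictlyInside ⟨a.len, a.len_pos, V k⟩ ⟨a.len, a.len_pos, V (k + 1)⟩) ∧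
      (∀ k, StrictlyInside ⟨a.len, a.len_pos, V k⟩ a) ∧
      ∀ F : Fin a.len → Set X, (∀ i, IsCompact (F i) ∧ F i ⊆ (a.sets i : Set X)) →
        ∃ k, ∀ i, F i ⊆ (V k i : Set X) := by
  choose V hmono hcpt hVa hV using fun i => exists_open_exhaustion (a.sets i)
  refine ⟨fun k i => V i k, fun k => ⟨rfl, fun i => hcpt i k⟩,
    fun k => ⟨rfl, fun i => ⟨(hcpt i k).1, hVa i k⟩⟩, fun F hF => ?_⟩
  choose k hk using fun i => hV i (F i) (hF i).2 (hF i).1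
  exact ⟨Finset.univ.sup k, fun i => (hk i).trans
    (hmono i (Finset.le_sup (Finset.mem_univ i)))⟩

/-- Subequivalence only tests compact subsets, and these fit into some tuple strictly inside `a`.
This is the core of (W2). -/
theorem subequiv_of_forall_strictlyInside [LocallyCompactSpace X] [T2Space X]
    {a b : OpenTuple X} (h : ∀ c, StrictlyInside c a → Subequiv Γ c b) : Subequiv Γ a b := by
  intro F hF
  have key : ∀ i, ∃ D : Opens X, F i ⊆ D ∧ closure (D : Set X) ⊆ a.sets i ∧
      IsCompact (closure (D : Set X)) := by
    intro i
    obtain ⟨D, hD, h⟩ :=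
      exists_open_between_and_isCompact_closure (hF i).1 (a.sets i).isOpen (hF i).2
    exact ⟨⟨D, hD⟩, h⟩
  choose D h1 h2 h3 using key
  exact h ⟨a.len, a.len_pos, D⟩ ⟨rfl, fun i => ⟨h3 i, h2 i⟩⟩ F fun i => ⟨(hF i).1, h1 i⟩

/-- Riesz-type decomposition of a tuple that embeds into a concatenation. -/
theorem exists_decomposition [LocallyCompactSpace X] [T2Space X] [ContinuousConstSMul Γ X]
    {a' a b c : OpenTuple X}
    (ha : StrictlyInside a' a) (h : Subequiv Γ a (b.append c)) :
    ∃ e f, Prec Γ a' (e.append f) ∧ Prec Γ e a ∧ Subequiv Γ e b ∧ Prec Γ f a ∧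
      Subequiv Γ f c := by
  obtain ⟨d, had, hda⟩ := ha.exists_between
  obtain ⟨D, rfl, hD⟩ := hda.exists_sets
  obtain ⟨J, U, s, k, h1, h2, h3⟩ := h (fun i => closure (D i : Set X)) hD
  change ∀ i, Fin (J i) → Fin (b.len + c.len) at k
  -- Handles both halves of the concatenation: `φ` is the inclusion of the levels of `g`, and `E`
  -- collects the pieces sent there.
  have part : ∀ (g : OpenTuple X) (φ : Fin g.len → Fin (b.len + c.len)),
      (∀ l, (b.append c).sets (φ l) = g.sets l) →
      ∃ E : Fin a.len → Opens X, Prec Γ ⟨a.len, a.len_pos, E⟩ a ∧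
        Subequiv Γ ⟨a.len, a.len_pos, E⟩ g ∧
        ∀ i, ∀ x ∈ D i, ∀ j, x ∈ U i j → k i j ∈ Set.range φ → x ∈ E i := by
    intro g φ hg
    -- Cutting down to `D`, which is strictly inside `a`, is what gives `≺ a`; the pieces `U i j`
    -- need not lie in `a`.
    refine ⟨fun i => (⨆ j : {j // k i j ∈ Set.range φ}, U i j.1) ⊓ D i, ⟨_,
      subequiv_of_le _ fun i => inf_le_right, hda⟩, ?_, fun i x hx j hj hk => ⟨?_, hx⟩⟩
    · classical
      refine subequiv_of_pieces (P := {p : Σ i, Fin (J i) // k p.1 p.2 ∈ Set.range φ})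
        (fun p => p.1.1) (fun p => U p.1.1 p.1.2) (fun p => s p.1.1 p.1.2)
        (fun p => p.2.choose) ?_ ?_ ?_
      · rintro i x ⟨hx, -⟩
        obtain ⟨j, hj⟩ := Opens.mem_iSup.1 hx
        exact ⟨⟨⟨i, j.1⟩, j.2⟩, rfl, hj⟩
      · intro p
        rw [← hg, p.2.choose_spec]
        exact h2 _ _
      · intro p q hpq hm
        refine h3 _ _ (fun h => hpq (Subtype.ext h)) ?_
        rw [← p.2.choose_spec, ← q.2.choose_spec, hm]
    · exact Opens.mem_iSup.2 ⟨⟨j, hk⟩, hj⟩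
  obtain ⟨E, hEa, hEb, hE⟩ := part b (Fin.castAdd c.len) (append_sets_left b c)
  obtain ⟨G, hGa, hGc, hG⟩ := part c (Fin.natAdd b.len) (append_sets_right b c)
  refine ⟨_, _, ?_, hEa, hEb, hGa, hGc⟩
  -- `D i` is covered by `E i` and `G i`. They may overlap, but they go to different levels, so
  -- trivial translations suffice.
  refine had.prec.mono (Subequiv.refl a') (subequiv_of_pieces (P := Fin a.len ⊕ Fin a.len)
    (Sum.elim id id) (Sum.elim E G) (fun _ => 1) finSumFinEquiv ?_ ?_
    fun p q hpq hm => absurd (finSumFinEquiv.injective hm) hpq)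
  · intro i x hx
    obtain ⟨j, hj⟩ := Set.mem_iUnion.1 (h1 i (subset_closure hx))
    obtain ⟨l, hl⟩ | ⟨l, hl⟩ : (k i j ∈ Set.range (Fin.castAdd c.len)) ∨
        k i j ∈ Set.range (Fin.natAdd b.len) := by
      induction k i j using Fin.addCases with
      | left l => exact Or.inl ⟨l, rfl⟩
      | right l => exact Or.inr ⟨l, rfl⟩
    · exact ⟨Sum.inl i, rfl, hE i x hx j hj ⟨l, hl⟩⟩
    · exact ⟨Sum.inr i, rfl, hG i x hx j hj ⟨l, hl⟩⟩
  · rintro (i | i)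
    · rw [one_smul, finSumFinEquiv_apply_left]
      exact (append_sets_left ⟨a.len, a.len_pos, E⟩ ⟨a.len, a.len_pos, G⟩ i).ge
    · rw [one_smul, finSumFinEquiv_apply_right]
      exact (append_sets_right ⟨a.len, a.len_pos, E⟩ ⟨a.len, a.len_pos, G⟩ i).ge

/-! ### Compact open tuples and complements in the zero-dimensional case. -/

section ZeroDimensional

theorem _root_.HasCompactOpenBasis.exists_between (hX : HasCompactOpenBasis X) {K : Set X}
    (hK : IsCompact K) {O : Opens X} (hKO : K ⊆ O) :
    ∃ D : Opens X, IsCompact (D : Set X) ∧ K ⊆ D ∧ D ≤ O := by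
  refine hK.induction_on (p := fun s => ∃ D : Opens X, IsCompact (D : Set X) ∧ s ⊆ D ∧ D ≤ O)
    ⟨⊥, by simp, Set.empty_subset _, bot_le⟩ ?_ ?_ ?_
  · rintro s t hst ⟨D, h1, h2, h3⟩
    exact ⟨D, h1, hst.trans h2, h3⟩
  · rintro s t ⟨D, h1, h2, h3⟩ ⟨E, h4, h5, h6⟩
    exact ⟨D ⊔ E, by simpa using h1.union h4, by simpa using Set.union_subset_union h2 h5,
      sup_le h3 h6⟩
  · intro x hx
    obtain ⟨D, ⟨hDo, hDc⟩, hxD, hDO⟩ := hX.exists_subset_of_mem_open (hKO hx) O.isOpen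
    exact ⟨D, mem_nhdsWithin_of_mem_nhds (hDo.mem_nhds hxD), ⟨D, hDo⟩, hDc, subset_rfl, hDO⟩

/-- After shrinking the cover to compact open sets, which are clopen, subtracting from each the
earlier ones keeps them compact and open. -/
theorem _root_.HasCompactOpenBasis.exists_disjoint_cover [T2Space X] (hX : HasCompactOpenBasis X)
    {K : Set X} (hK : IsCompact K) {n : ℕ} {U : Fin n → Opens X} (hKU : K ⊆ ⋃ j, (U j : Set X)) :
    ∃ P : Fin n → Opens X, (∀ j, IsCompact (P j : Set X)) ∧ (∀ j, P j ≤ U j) ∧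
      (∀ i j, i ≠ j → Disjoint (P i : Set X) (P j : Set X)) ∧ K ⊆ ⋃ j, (P j : Set X) := by
  obtain ⟨C, hC, hCU, hKC⟩ := hK.finite_compact_cover Finset.univ (fun j => (U j : Set X))
    (fun j _ => (U j).isOpen) (by simpa using hKU)
  choose D hDc hCD hDU using fun j => hX.exists_between (hC j) (hCU j)
  have hcl : ∀ j, IsClosed (⋃ i : {i // i < j}, (D i : Set X)) := fun j =>
    isClosed_iUnion_of_finite fun i => (hDc i.1).isClosed
  have hop : ∀ j, IsOpen (⋃ i : {i // i < j}, (D i : Set X)) := fun j =>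
    isOpen_iUnion fun i => (D i.1).isOpen
  refine ⟨fun j => ⟨(D j : Set X) \ ⋃ i : {i // i < j}, (D i : Set X),
    (D j).isOpen.sdiff (hcl j)⟩, fun j => (hDc j).diff (hop j),
    fun j => Set.sdiff_subset.trans (hDU j), ?_, fun x hx => ?_⟩
  · have key : ∀ i j, i < j → Disjoint ((D i : Set X) \ ⋃ l : {l // l < i}, (D l : Set X))
        ((D j : Set X) \ ⋃ l : {l // l < j}, (D l : Set X)) := fun i j hij =>
      Set.disjoint_left.2 fun x hx hx' => hx'.2 (Set.mem_iUnion.2 ⟨⟨i, hij⟩, hx.1⟩)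
    intro i j hij
    rcases lt_or_gt_of_ne hij with h | h
    · exact key i j h
    · exact (key j i h).symm
  · rw [hKC] at hx
    simp only [Finset.mem_univ, Set.iUnion_true, Set.mem_iUnion] at hx
    obtain ⟨j, hj⟩ := hx
    obtain ⟨m, hm, hmin⟩ := wellFounded_lt.has_min {j : Fin n | x ∈ D j} ⟨j, hCD j hj⟩
    exact Set.mem_iUnion.2 ⟨m, hm, fun h => by
      obtain ⟨l, hl⟩ := Set.mem_iUnion.1 h
      exact hmin l hl l.2⟩

/-- Compact open tuples satisfy `a ≺ a`, so for them `≼` can be upgraded to `≺`. -/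
theorem strictlyInside_self [T2Space X] {a : OpenTuple X}
    (ha : ∀ i, IsCompact (a.sets i : Set X)) : StrictlyInside a a :=
  ⟨rfl, fun i => by simpa [(ha i).isClosed.closure_eq] using ha i⟩

theorem StrictlyInside.exists_compact (hX : HasCompactOpenBasis X) {c a : OpenTuple X}
    (h : StrictlyInside c a) : ∃ d : OpenTuple X, (∀ i, IsCompact (d.sets i : Set X)) ∧
      Subequiv Γ c d ∧ Subequiv Γ d a := by
  obtain ⟨C, rfl, hC⟩ := h.exists_sets
  choose D h1 h2 h3 using fun i => hX.exists_between (hC i).1 (hC i).2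
  exact ⟨⟨a.len, a.len_pos, D⟩, h1, subequiv_of_le _ fun i => subset_closure.trans (h2 i),
    subequiv_of_le _ h3⟩

theorem Prec.exists_compact [T2Space X] [ContinuousConstSMul Γ X]
    (hX : HasCompactOpenBasis X) {c a : OpenTuple X}
    (h : Prec Γ c a) : ∃ d : OpenTuple X, (∀ i, IsCompact (d.sets i : Set X)) ∧
      Subequiv Γ c d ∧ Subequiv Γ d a := by
  obtain ⟨e, hce, hea⟩ := h
  obtain ⟨d, hd, hed, hda⟩ := hea.exists_compact (Γ := Γ) hX
  exact ⟨d, hd, hce.trans hed, hda⟩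

/-- Among tuples of compact open sets, `a + b ≼ c` implies `c ≈ a + x` for some `x` above `b`. -/
theorem exists_complement [T2Space X] [ContinuousConstSMul Γ X] (hX : HasCompactOpenBasis X)
    {a b c : OpenTuple X} (ha : ∀ i, IsCompact (a.sets i : Set X))
    (hb : ∀ i, IsCompact (b.sets i : Set X)) (hc : ∀ i, IsCompact (c.sets i : Set X))
    (h : Subequiv Γ (a.append b) c) :
    ∃ x : OpenTuple X, (∀ i, IsCompact (x.sets i : Set X)) ∧ Subequiv Γ (a.append x) c ∧
      Subequiv Γ c (a.append x) ∧ Subequiv Γ b x := by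
  classical
  -- Compactness allows the whole tuple to be taken as the test sets, so one embedding moves all of
  -- `a` and `b`.
  obtain ⟨J, U, s, k, h1, h2, h3⟩ := h (fun i => (a.append b).sets i) fun i => by
    refine ⟨?_, subset_rfl⟩
    change Fin (a.len + b.len) at i
    induction i using Fin.addCases with
    | left i => simpa [append] using ha i
    | right i => simpa [append] using hb i
  let l : Fin a.len → Fin (a.append b).len := Fin.castAdd b.len
  have hl : ∀ i, (a.append b).sets (l i) = a.sets i := append_sets_left a b
  have hcov : ∀ i, (a.sets i : Set X) ⊆ ⋃ j, (U (l i) j : Set X) := fun i => by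
    rw [← hl]
    exact h1 (l i)
  choose P₀ hP₀c hP₀U hP₀d hP₀ using fun i => hX.exists_disjoint_cover (ha i) (hcov i)
  -- The `P i j` partition `a.sets i` exactly, so the embedding can be reversed: translating back
  -- lands disjointly inside `a`.
  let P : ∀ i, Fin (J (l i)) → Opens X := fun i j => P₀ i j ⊓ a.sets i
  have hPc : ∀ i j, IsCompact (P i j : Set X) := fun i j =>
    (hP₀c i j).inter_right (ha i).isClosed
  have hPU : ∀ i j, (P i j : Set X) ⊆ U (l i) j := fun i j =>
    Set.inter_subset_left.trans (hP₀U i j)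
  have hPd : ∀ i j j', j ≠ j' → Disjoint (P i j : Set X) (P i j' : Set X) := fun i j j' hj =>
    (hP₀d i j j' hj).mono Set.inter_subset_left Set.inter_subset_left
  have hP : ∀ i, ∀ x ∈ a.sets i, ∃ j, x ∈ P i j := fun i x hx => by
    obtain ⟨j, hj⟩ := Set.mem_iUnion.1 (hP₀ i hx)
    exact ⟨j, hj, hx⟩
  let Q : (Σ i, Fin (J (l i))) → Opens X := fun p =>
    ⟨s (l p.1) p.2 • (P p.1 p.2 : Set X), (P p.1 p.2).isOpen.smul _⟩
  have hQc : ∀ p, IsCompact (Q p : Set X) := fun p => (hPc p.1 p.2).smul _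
  have hQU : ∀ p, (Q p : Set X) ⊆ s (l p.1) p.2 • (U (l p.1) p.2 : Set X) := fun p =>
    Set.smul_set_mono (hPU p.1 p.2)
  let κ : (Σ i, Fin (J (l i))) → Fin c.len := fun p => k (l p.1) p.2
  have hQκ : ∀ p, (Q p : Set X) ⊆ c.sets (κ p) := fun p => (hQU p).trans (h2 _ _)
  have hQd : ∀ p q, p ≠ q → κ p = κ q → Disjoint (Q p : Set X) (Q q : Set X) := by
    rintro ⟨i, j⟩ ⟨i', j'⟩ hpq hκ
    refine (h3 ⟨l i, j⟩ ⟨l i', j'⟩ (fun h => hpq ?_) hκ).mono (hQU _) (hQU _)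
    obtain ⟨h, h'⟩ := Sigma.mk.inj_iff.1 h
    obtain rfl := Fin.castAdd_injective _ _ h
    rw [eq_of_heq h']
  -- `R m` is the part of level `m` of `c` occupied by the copy of `a`; the complement `Y m` is
  -- clopen in it.
  let R : Fin c.len → Set X := fun m => ⋃ p : {p // κ p = m}, (Q p.1 : Set X)
  let Y : Fin c.len → Opens X := fun m => ⟨(c.sets m : Set X) \ R m,
    (c.sets m).isOpen.sdiff (isClosed_iUnion_of_finite fun p => (hQc p.1).isClosed)⟩
  have hYc : ∀ m, IsCompact (Y m : Set X) := fun m =>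
    (hc m).diff (isOpen_iUnion fun p => (Q p.1).isOpen)
  have hQY : ∀ p m, κ p = m → Disjoint (Q p : Set X) (Y m : Set X) := fun p m hp =>
    Set.disjoint_left.2 fun x hx hx' => hx'.2 (Set.mem_iUnion.2 ⟨⟨p, hp⟩, hx⟩)
  refine ⟨⟨c.len, c.len_pos, Y⟩, hYc, ?_, ?_, ?_⟩
  · refine subequiv_of_pieces (P := (Σ i, Fin (J (l i))) ⊕ Fin c.len)
      (Sum.elim (fun p => Fin.castAdd c.len p.1) (Fin.natAdd a.len))
      (Sum.elim (fun p => P p.1 p.2) Y) (Sum.elim (fun p => s (l p.1) p.2) fun _ => 1)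
      (Sum.elim κ id) ?_ ?_ ?_
    · intro i x hx
      change Fin (a.len + c.len) at i
      induction i using Fin.addCases with
      | left i =>
        obtain ⟨j, hj⟩ := hP i x (by simpa [append] using hx)
        exact ⟨Sum.inl ⟨i, j⟩, rfl, hj⟩
      | right i => exact ⟨Sum.inr i, rfl, by simpa [append] using hx⟩
    · rintro (p | m)
      · exact hQκ p
      · change (1 : Γ) • (Y m : Set X) ⊆ c.sets m
        rw [one_smul]
        exact Set.sdiff_subset
    · rintro (p | m) (q | m') hne hm
      · exact hQd p q (fun h => hne (congrArg _ h)) hm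
      · change Disjoint (Q p : Set X) ((1 : Γ) • (Y m' : Set X))
        rw [one_smul]
        exact hQY p m' hm
      · change Disjoint ((1 : Γ) • (Y m : Set X)) (Q q : Set X)
        rw [one_smul]
        exact (hQY q m hm.symm).symm
      · exact absurd (congrArg _ hm) hne
  · refine subequiv_of_pieces (P := (Σ i, Fin (J (l i))) ⊕ Fin c.len)
      (Sum.elim κ id) (Sum.elim Q Y) (Sum.elim (fun p => (s (l p.1) p.2)⁻¹) fun _ => 1)
      (Sum.elim (fun p => Fin.castAdd c.len p.1) (Fin.natAdd a.len)) ?_ ?_ ?_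
    · intro m x hx
      by_cases hxR : x ∈ R m
      · obtain ⟨p, hp⟩ := Set.mem_iUnion.1 hxR
        exact ⟨Sum.inl p.1, p.2, hp⟩
      · exact ⟨Sum.inr m, rfl, hx, hxR⟩
    · rintro (⟨i, j⟩ | m)
      · change (s (l i) j)⁻¹ • s (l i) j • (P i j : Set X) ⊆ (a.append ⟨c.len, c.len_pos, Y⟩).sets
          (Fin.castAdd c.len i)
        rw [inv_smul_smul, append_sets_left]
        exact Set.inter_subset_right
      · simp [append]
    · rintro (⟨i, j⟩ | m) (⟨i', j'⟩ | m') hne hm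
      · obtain rfl : i = i' := Fin.castAdd_injective _ _ hm
        simpa [Q] using hPd i j j' (fun h => hne (by rw [h]))
      · have : (i : ℕ) = a.len + (m' : ℕ) := congrArg Fin.val hm
        omega
      · have : a.len + (m : ℕ) = (i' : ℕ) := congrArg Fin.val hm
        omega
      · exact absurd (congrArg _ (Fin.natAdd_injective _ _ hm)) hne
  · let ρ : Fin b.len → Fin (a.append b).len := Fin.natAdd a.len
    have hρ : ∀ i, (a.append b).sets (ρ i) = b.sets i := append_sets_right a b
    refine subequiv_of_pieces (P := Σ i, Fin (J (ρ i))) (fun p => p.1) (fun p => U (ρ p.1) p.2)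
      (fun p => s (ρ p.1) p.2) (fun p => k (ρ p.1) p.2) ?_ ?_ ?_
    · intro i x hx
      rw [← hρ] at hx
      obtain ⟨j, hj⟩ := Set.mem_iUnion.1 (h1 (ρ i) hx)
      exact ⟨⟨i, j⟩, rfl, hj⟩
    · rintro ⟨i, j⟩ x hx
      refine ⟨h2 _ _ hx, fun hxR => ?_⟩
      obtain ⟨⟨p, hp⟩, hxp⟩ := Set.mem_iUnion.1 hxR
      -- The original embedding keeps the images of `b` disjoint from those of `a`, so they avoid
      -- `R` and fall into `Y`.
      refine Set.disjoint_left.1 (h3 ⟨l p.1, p.2⟩ ⟨ρ i, j⟩ (fun h => ?_) hp) (hQU p hxp) hx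
      have := congrArg (fun q => Fin.val (Sigma.fst q)) h
      simp only [l, ρ, Fin.val_castAdd, Fin.val_natAdd] at this
      omega
    · rintro ⟨i, j⟩ ⟨i', j'⟩ hpq hκ
      refine h3 ⟨ρ i, j⟩ ⟨ρ i', j'⟩ (fun h => hpq ?_) hκ
      obtain ⟨h, h'⟩ := Sigma.mk.inj_iff.1 h
      obtain rfl := Fin.natAdd_injective _ _ h
      rw [eq_of_heq h']

end ZeroDimensional

end OpenTuple

/-! ### The axioms (W1)-(W6) for the generalized type semigroup. -/

namespace GenTypeSemigroup

open OpenTuple (Subequiv StrictlyInside)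

variable (X : Type u) (Γ : Type v) [TopologicalSpace X] [T2Space X] [LocallyCompactSpace X]
    [Group Γ] [MulAction Γ X] [ContinuousConstSMul Γ X]

/-- The class of a tuple. -/
def mk (a : OpenTuple X) : GenTypeSemigroup X Γ := Quotient.mk (OpenTuple.setoid X Γ) a

variable {X Γ}

theorem prec_of_strictlyInside {a b : OpenTuple X} (h : StrictlyInside a b) :
    Prec X Γ (mk X Γ a) (mk X Γ b) :=
  OpenTuple.StrictlyInside.prec h

variable (X Γ)

omit [LocallyCompactSpace X] in
theorem isPositivelyOrdered : IsPositivelyOrdered (GenTypeSemigroup X Γ) where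
  add_le_add_right := by
    rintro ⟨a⟩ ⟨b⟩ ⟨c⟩ hab
    exact OpenTuple.subequiv_append hab (Subequiv.refl c)
  zero_le := by
    rintro ⟨a⟩
    exact OpenTuple.subequiv_of_map (fun _ => ⟨0, a.len_pos⟩) (fun _ => bot_le)
      fun _ _ h => absurd (Subsingleton.elim (α := Fin 1) _ _) h

theorem isAuxiliary : IsAuxiliary (Prec X Γ) where
  le_of_rel := by
    rintro ⟨a⟩ ⟨b⟩ ⟨c, hac, hcb⟩
    exact Subequiv.trans hac hcb.subequiv
  rel_of_le_of_rel_of_le := by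
    rintro ⟨a⟩ ⟨b⟩ ⟨c⟩ ⟨d⟩ hab hbc hcd
    exact OpenTuple.Prec.mono hab hbc hcd
  zero_rel := by
    rintro ⟨a⟩
    -- Zero is represented in length one, but `≪` demands equal lengths, hence a tuple of empty sets
    -- as long as `a`.
    refine ⟨⟨a.len, a.len_pos, fun _ => ⊥⟩, (isPositivelyOrdered X Γ).zero_le (mk X Γ _), rfl,
      fun i => by simp⟩

theorem isWSemigroup [SecondCountableTopology X] :
    IsWSemigroup (GenTypeSemigroup X Γ) (Prec X Γ) where
  positivelyOrdered := isPositivelyOrdered X Γ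
  auxiliary := isAuxiliary X Γ
  w1 := by
    rintro ⟨a⟩
    obtain ⟨V, hV, hVa, hcof⟩ := a.exists_exhaustion
    refine ⟨fun k => mk X Γ ⟨a.len, a.len_pos, V k⟩, fun k => prec_of_strictlyInside (hVa k),
      fun k => prec_of_strictlyInside (hV k), ?_⟩
    rintro ⟨b⟩ ⟨c, hbc, hca⟩
    obtain ⟨C, rfl, hC⟩ := hca.exists_sets
    obtain ⟨k, hk⟩ := hcof _ hC
    exact ⟨k, ⟨a.len, a.len_pos, C⟩, hbc, rfl, fun i => ⟨(hC i).1, hk i⟩⟩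
  w2 := by
    rintro ⟨a⟩
    refine ⟨fun b hb => (isAuxiliary X Γ).le_of_rel _ _ hb, ?_⟩
    rintro ⟨b⟩ hb
    exact OpenTuple.subequiv_of_forall_strictlyInside fun c hc =>
      hb (a := mk X Γ c) (prec_of_strictlyInside hc)
  w3 := by
    rintro ⟨a'⟩ ⟨a⟩ ⟨b'⟩ ⟨b⟩ ⟨c, hc, hca⟩ ⟨d, hd, hdb⟩
    exact ⟨c.append d, OpenTuple.subequiv_append hc hd, hca.append hdb⟩
  w4 := by
    rintro ⟨a⟩ ⟨b⟩ ⟨c⟩ ⟨d, had, hd⟩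
    obtain ⟨e, f, rfl, he, hf⟩ := hd.exists_append
    obtain ⟨b', heb, hb⟩ := he.exists_between
    obtain ⟨c', hfc, hc⟩ := hf.exists_between
    exact ⟨mk X Γ b', mk X Γ c', ⟨e.append f, had, heb.append hfc⟩, prec_of_strictlyInside hb,
      prec_of_strictlyInside hc⟩

theorem axiomW6 : AxiomW6 (Prec X Γ) := by
  rintro ⟨a'⟩ ⟨a⟩ ⟨b⟩ ⟨c⟩ ⟨d, had, hda⟩ ⟨g, hag, hg⟩
  obtain ⟨g₁, g₂, rfl, hb, hc⟩ := hg.exists_append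
  obtain ⟨e, f, hef, hea, heb, hfa, hfc⟩ := OpenTuple.exists_decomposition hda hag
  exact ⟨mk X Γ e, mk X Γ f, hef.mono had (Subequiv.refl _), hea, ⟨g₁, heb, hb⟩, hfa,
    ⟨g₂, hfc, hc⟩⟩

/-- Compact open tuples `A`, `B`, `C` are inserted into the three strict relations, and the exact
complement `Y` of `A` in `C` serves as both `x'` and `x`, since `Y ≺ Y`. -/
theorem axiomW5 (hX : HasCompactOpenBasis X) : AxiomW5 (Prec X Γ) := by
  rintro ⟨a'⟩ ⟨a⟩ ⟨b'⟩ ⟨b⟩ ⟨c⟩ ⟨d⟩ habc ha hb hcd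
  obtain ⟨A, hA, haA, hAa⟩ := OpenTuple.Prec.exists_compact hX ha
  obtain ⟨B, hB, hbB, hBb⟩ := OpenTuple.Prec.exists_compact hX hb
  obtain ⟨C, hC, hcC, hCd⟩ := OpenTuple.Prec.exists_compact hX hcd
  obtain ⟨Y, hY, hAY, hYA, hBY⟩ := OpenTuple.exists_complement hX hA hB hC
    (((OpenTuple.subequiv_append hAa hBb).trans
      ((isAuxiliary X Γ).le_of_rel (mk X Γ (a.append b)) (mk X Γ c) habc)).trans hcC)
  have hCC := (OpenTuple.strictlyInside_self hC).prec (Γ := Γ)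
  have hYY := (OpenTuple.strictlyInside_self hY).prec (Γ := Γ)
  exact ⟨mk X Γ Y, mk X Γ Y,
    hCC.mono ((OpenTuple.subequiv_append haA (Subequiv.refl Y)).trans hAY) hCd,
    hCC.mono hcC (hYA.trans (OpenTuple.subequiv_append hAa (Subequiv.refl Y))),
    hYY.mono (hbB.trans hBY) (Subequiv.refl Y), hYY⟩

end GenTypeSemigroup

theorem mainTheorem5 (X : Type u) (Γ : Type v)
    [TopologicalSpace X] [T2Space X] [LocallyCompactSpace X] [SecondCountableTopology X]
    [Group Γ] [Countable Γ] [Infinite Γ] [MulAction Γ X] [ContinuousConstSMul Γ X] :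
    ∃ hW : IsWSemigroup (GenTypeSemigroup X Γ) (GenTypeSemigroup.Prec X Γ),
      AxiomW6 (GenTypeSemigroup.Prec X Γ) ∧
      IsCuSemigroup (CuCompletion hW) ∧
      AxiomO6 (CuCompletion hW) ∧
      (HasCompactOpenBasis X →
        AxiomW5 (GenTypeSemigroup.Prec X Γ) ∧ AxiomO5 (CuCompletion hW)) :=
  have h6 := GenTypeSemigroup.axiomW6 X Γ
  have hW := GenTypeSemigroup.isWSemigroup X Γ
  ⟨hW, h6, CuCompletion.isCuSemigroup hW, CuCompletion.axiomO6 hW h6, fun hX =>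
    ⟨GenTypeSemigroup.axiomW5 X Γ hX, CuCompletion.axiomO5 hW (GenTypeSemigroup.axiomW5 X Γ hX)⟩⟩
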